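/- Let $d\ge 2$, $\nu_d=\frac{d-2}{2}$, let $\mathbb B^d\subset\mathbb R^d$ be the open unit ball and $\mathbb S^{d-1}$ its boundary. For real $q\in L^\infty(\mathbb B^d)$ and real $\kappa$ that is not a Dirichlet eigenvalue of $-\Delta+q$ on $\mathbb B^d$, the Dirichlet-to-Neumann map $\Lambda_{q,\kappa}$ sends $f\in C^\infty(\mathbb S^{d-1})$ to $\partial_\nu v|_{\mathbb S^{d-1}}$, where $v\in H^1(\mathbb B^d)$ is the weak solution of $-\Delta v+qv-\kappa v=0$ in $\mathbb B^d$ with $v|_{\mathbb S^{d-1}}=f$ and $\partial_\nu$ is the (weak) outer normal derivative. If $q$ is radial, $\lambda_\ell[q,\kappa]$ denotes the number by which $\Lambda_{q,\kappa}$ acts on the spherical harmonics of degree $\ell$ on $\mathbb S^{d-1}$. Put $$\varphi_\ell(z)=\frac{J_{\ell+\nu_d}(z)}{z^{\nu_d}}=\frac{z^\ell}{2^{\ell+\nu_d}}\sum_{n=0}^\infty\frac{(-1)^n}{n!\,\Gamma(\ell+\nu_d+n+1)}\Big(\frac z2\Big)^{2n},\qquad \sigma_\ell[q,\kappa]=\frac1{|\mathbb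 S^{d-1}|}\int_{\mathbb B^d}q(x)\,\varphi_\ell(\sqrt\kappa\,|x|)^2\,dx .$$ **Proposition.** Let $q\in L^\infty(\mathbb B^d;\mathbb R)$ be radial. For every $\kappa\le-\|q\|_{L^\infty(\mathbb B^d)}$ and every integer $\ell\ge0$ the numbers $\lambda_\ell[q,\kappa]$ and $\lambda_\ell[0,\kappa]$ are well defined (they exist and are unique), and, if $(d,\ell)\ne(2,0)$, $$\left|\lambda_\ell[q,\kappa]-\lambda_\ell[0,\kappa]-\frac{\sigma_\ell[q,\kappa]}{\varphi_\ell(\sqrt\kappa)^2}\right|\le\frac{\|q\|_{L^\infty(\mathbb B^d)}^2}{2(\ell+\nu_d)\left((\ell+\nu_d)^2-\|q\|_{L^\infty(\mathbb B^d)}-\kappa\right)} .$$ (For $\kappa=0$, which is allowed only if $q=0$ almost everywhere, the quotient $\sigma_\ell/\varphi_\ell^2$ is read as $0$; for $(d,\ell)=(2,0)$ the right-hand side is infinite.) Moreover, the eigenvalues of $\Lambda_{q,\kappa}-\Lambda_{0,\kappa}$ are, uniformly in $\ell$, asymptotic to the rescaled moments, which depend linearly on $q$: $$\lim_{\kappa\to-\infty}\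 \sup_{\ell\ge0}\left|\lambda_\ell[q,\kappa]-\lambda_\ell[0,\kappa]-\frac{\sigma_\ell[q,\kappa]}{\varphi_\ell(\sqrt\kappa)^2}\right|=0 .$$ -/

import Mathlib

open MeasureTheory Filter Topology
open scoped ContDiff ENNReal

noncomputable section

namespace RadialDtN

/-- Euclidean space `ℝ^d`. -/
abbrev Sp (d : ℕ) : Type := EuclideanSpace ℝ (Fin d)

/-- The open unit ball `𝔹^d`. -/
abbrev unitBall (d : ℕ) : Set (Sp d) := Metric.ball 0 1

/-- The unit sphere `𝕊^{d-1}`. -/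
abbrev unitSphere (d : ℕ) : Set (Sp d) := Metric.sphere 0 1

/-- Lebesgue measure on the open unit ball. -/
abbrev ballMeasure (d : ℕ) : Measure (Sp d) := volume.restrict (unitBall d)

/-- The (unnormalised) surface measure on the unit sphere. -/
abbrev sphereMeasure (d : ℕ) : Measure (unitSphere d) := (volume : Measure (Sp d)).toSphere

/-- `ν_d = (d - 2) / 2`. -/
def nu (d : ℕ) : ℝ := ((d : ℝ) - 2) / 2

/-- `q ∈ L^∞_rad(𝔹^d; ℝ)`: `q` is essentially bounded on the ball and agrees almost everywhere
with a function of `|x|`. -/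
structure IsBoundedRadial {d : ℕ} (q : Sp d → ℝ) : Prop where
  memLp : MemLp q ∞ (ballMeasure d)
  radial : ∃ q₀ : ℝ → ℝ, ∀ᵐ x ∂ballMeasure d, q x = q₀ ‖x‖

/-- The norm of `q` in `L^∞(𝔹^d)`. -/
def supNorm {d : ℕ} (q : Sp d → ℝ) : ℝ := (eLpNorm q ∞ (ballMeasure d)).toReal

/-! ### Sobolev spaces on the ball -/

/-- `φ ∈ C_c^∞(𝔹^d)`. -/
structure IsTestFunction {d : ℕ} (φ : Sp d → ℝ) : Prop where
  smooth : ContDiff ℝ ∞ φ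
  compact : HasCompactSupport φ
  support : tsupport φ ⊆ unitBall d

/-- `u ∈ H^1(𝔹^d)` with weak gradient `G`. -/
structure IsH1 {d : ℕ} (u : Sp d → ℝ) (G : Sp d → Sp d) : Prop where
  memLp : MemLp u 2 (ballMeasure d)
  memLp_grad : MemLp G 2 (ballMeasure d)
  weak_grad : ∀ φ : Sp d → ℝ, IsTestFunction φ →
    ∫ x in unitBall d, u x • gradient φ x = - ∫ x in unitBall d, φ x • G x

/-- `u ∈ H^1_0(𝔹^d)` with weak gradient `G`: `(u, G)` is the limit in `L^2 × L^2` of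
`(φ n, ∇ φ n)` for a sequence of test functions `φ n`. -/
structure IsH10 {d : ℕ} (u : Sp d → ℝ) (G : Sp d → Sp d) : Prop where
  isH1 : IsH1 u G
  approx : ∃ φ : ℕ → Sp d → ℝ, (∀ n, IsTestFunction (φ n)) ∧
    Tendsto (fun n => eLpNorm (fun x => u x - φ n x) 2 (ballMeasure d)) atTop (𝓝 0) ∧
    Tendsto (fun n => eLpNorm (fun x => G x - gradient (φ n) x) 2 (ballMeasure d)) atTop (𝓝 0)

/-! ### The Dirichlet problem and the Dirichlet-to-Neumann map -/

/-- The smooth function `f` on the sphere is the boundary value of the `H^1` function `u` with weak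
gradient `G`: for some smooth extension `F` of `f`, `u - F` belongs to `H^1_0(𝔹^d)`. -/
def HasBoundaryValue {d : ℕ} (u : Sp d → ℝ) (G : Sp d → Sp d) (f : unitSphere d → ℝ) : Prop :=
  ∃ F : Sp d → ℝ, ContDiff ℝ ∞ F ∧ (∀ y : unitSphere d, F y = f y) ∧
    IsH10 (fun x => u x - F x) (fun x => G x - gradient F x)

/-- The bilinear form `∫_𝔹 (∇v · ∇w + (q - κ) v w) dx`, where `G` is the weak gradient of `v` and
`w` is smooth. -/
def energy {d : ℕ} (q : Sp d → ℝ) (κ : ℝ) (v : Sp d → ℝ) (G : Sp d → Sp d) (w : Sp d → ℝ) : ℝ :=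
  ∫ x in unitBall d, (inner ℝ (G x) (gradient w x) + (q x - κ) * v x * w x)

/-- `v ∈ H^1(𝔹^d)`, with weak gradient `G`, is a weak solution of `-Δv + q v - κ v = 0` in `𝔹^d`,
`v = f` on `𝕊^{d-1}`. -/
structure IsDirichletSolution {d : ℕ} (q : Sp d → ℝ) (κ : ℝ) (f : unitSphere d → ℝ)
    (v : Sp d → ℝ) (G : Sp d → Sp d) : Prop where
  isH1 : IsH1 v G
  boundary : HasBoundaryValue v G f
  weak_eq : ∀ φ : Sp d → ℝ, IsTestFunction φ → energy q κ v G φ = 0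

/-- `g = Λ_{q,κ} f`: `g` is the normal derivative on the sphere, in the weak sense given by
Green's formula, of a solution of the Dirichlet problem with boundary value `f`. -/
def IsDtN {d : ℕ} (q : Sp d → ℝ) (κ : ℝ) (f g : unitSphere d → ℝ) : Prop :=
  ∃ (v : Sp d → ℝ) (G : Sp d → Sp d), IsDirichletSolution q κ f v G ∧
    MemLp g 2 (sphereMeasure d) ∧
    ∀ w : Sp d → ℝ, ContDiff ℝ ∞ w →
      energy q κ v G w = ∫ y : unitSphere d, g y * w y ∂sphereMeasure d

/-- `Y` is a (real) spherical harmonic of degree `ℓ` on `𝕊^{d-1}`: the restriction to the sphere of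
a homogeneous harmonic polynomial of degree `ℓ`. -/
def IsSphericalHarmonic (d ℓ : ℕ) (Y : unitSphere d → ℝ) : Prop :=
  ∃ P : MvPolynomial (Fin d) ℝ, P.IsHomogeneous ℓ ∧
    ∑ i, MvPolynomial.pderiv i (MvPolynomial.pderiv i P) = 0 ∧
    ∀ y : unitSphere d, Y y = MvPolynomial.eval (fun i => (y : Sp d) i) P

/-- `Λ_{q,κ}` acts on the spherical harmonics of degree `ℓ` as multiplication by `lam`. -/
def IsDtNEigenvalue {d : ℕ} (q : Sp d → ℝ) (κ : ℝ) (ℓ : ℕ) (lam : ℝ) : Prop :=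
  ∀ Y : unitSphere d → ℝ, IsSphericalHarmonic d ℓ Y → IsDtN q κ Y (fun y => lam * Y y)

/-- `λ_ℓ[q,κ]`, the eigenvalue of `Λ_{q,κ}` on the spherical harmonics of degree `ℓ`. -/
def dtnEigenvalue {d : ℕ} (q : Sp d → ℝ) (κ : ℝ) (ℓ : ℕ) : ℝ :=
  Classical.epsilon (IsDtNEigenvalue q κ ℓ)

/-! ### The moments -/

/-- `φ_ℓ(z) = J_{ℓ+ν_d}(z) / z^{ν_d}`, an entire function of `z`, through its power series. -/
def phi (d ℓ : ℕ) (z : ℂ) : ℂ :=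
  z ^ ℓ / (((2 : ℝ) ^ ((ℓ : ℝ) + nu d) : ℝ) : ℂ) *
    ∑' n : ℕ, (-1 : ℂ) ^ n / ((n.factorial : ℂ) * (Real.Gamma (ℓ + nu d + n + 1) : ℂ)) *
      (z / 2) ^ (2 * n)

/-- A square root of `κ` (the choice of the root is irrelevant for `φ_ℓ(√κ r)^2`). -/
def csqrt (κ : ℝ) : ℂ := (κ : ℂ) ^ (1 / 2 : ℂ)

/-- The `κ`-moment `σ_ℓ[q,κ] = |𝕊^{d-1}|⁻¹ ∫_𝔹 q(x) φ_ℓ(√κ |x|)^2 dx`. -/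
def moment {d : ℕ} (q : Sp d → ℝ) (κ : ℝ) (ℓ : ℕ) : ℂ :=
  (((sphereMeasure d).real Set.univ : ℝ) : ℂ)⁻¹ *
    ∫ x in unitBall d, (q x : ℂ) * phi d ℓ (csqrt κ * (‖x‖ : ℂ)) ^ 2

/-- `λ_ℓ[q,κ] - λ_ℓ[0,κ] - σ_ℓ[q,κ] / φ_ℓ(√κ)^2`. -/
def spectralGap {d : ℕ} (q : Sp d → ℝ) (κ : ℝ) (ℓ : ℕ) : ℂ :=
  (dtnEigenvalue q κ ℓ : ℂ) - (dtnEigenvalue (0 : Sp d → ℝ) κ ℓ : ℂ) -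
    moment q κ ℓ / phi d ℓ (csqrt κ) ^ 2

end RadialDtN

end

noncomputable section

namespace RadialDtN

/-! ### The radial ordinary differential equation -/

/-! Separate variables. For a solid harmonic `H` of degree `ℓ`, the function `a(|x|) H(x)` solves
the equation when `(r^N a')' = r^N Q a`, with `N = d - 1 + 2ℓ` and `Q` the radial profile of `q -
κ`. The condition `κ ≤ -‖q‖` gives `Q ≥ 0`, so the regular solution, a Neumann series of nonnegative
terms, is increasing and at least `1`. Normalise it to `α` with `α(1) = 1`: then `αH` has boundary
value `H`, and `λ_ℓ = ℓ + α'(1)`. This existence part is `energy_separatedSol` (Green's formula) and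
`isH10_separatedSol_sub` (boundary value). Uniqueness of `λ_ℓ` needs no uniqueness for the Dirichlet
problem: pairing two solutions in both orders and using the symmetry of the energy form suffices
(`isDtN_smul_unique`).

For `q = 0` let `β` be the normalised solution. Its series is the Bessel series, so for `κ ≠ 0` one
has `r^ℓ β(r) = φ_ℓ(√κ r) / φ_ℓ(√κ)`, and the rescaled moment equals `∫ r^N q β²` over `(0,1)`
(`moment_div_phi`). Alessandrini's identity `α'(1) - β'(1) = ∫ r^N q α β` (`normFlux_sub_normFlux`)
turns the quantity to be estimated into `G = ∫ r^N q β u`, where `u = α - β` and `u(1) = 0`.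

Since `(r^N u')' = r^N Q u + r^N q β`, testing with `u` gives `-G = ∫ r^N (u'² + Q u²)`. A Hardy
inequality on `(0,1)` bounds this below by `D ∫ r^N u²` with `D = (ℓ + ν_d)² - ‖q‖ - κ`. Young's
inequality and `0 ≤ β ≤ 1` then yield `|G| ≤ (‖q‖² / D) ∫ r^N = ‖q‖² / ((2(ℓ + ν_d) + 2) D)`
(`abs_gap_le`). The summand `2` is dropped in the stated bound, but it keeps the estimate finite for
`(d, ℓ) = (2, 0)` and so gives the limit uniformly in `ℓ`. -/

/-- The terms of the Neumann series of the regular solution of `(r^N a')' = r^N Q a`. -/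
def radialTerm (N : ℕ) (Q : ℝ → ℝ) : ℕ → ℝ → ℝ
  | 0 => fun _ => 1
  | n + 1 => fun r => ∫ s in (0 : ℝ)..|r|, (s ^ N)⁻¹ * ∫ t in (0 : ℝ)..s,
      t ^ N * Q t * radialTerm N Q n t

/-- The regular solution of `(r^N a')' = r^N Q a` with value `1` at the origin. -/
def radialSol (N : ℕ) (Q : ℝ → ℝ) (r : ℝ) : ℝ := ∑' n, radialTerm N Q n r

/-- The flux `r^N a'` of the regular solution. -/
def radialFlux (N : ℕ) (Q : ℝ → ℝ) (r : ℝ) : ℝ :=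
  ∫ t in (0 : ℝ)..r, t ^ N * Q t * radialSol N Q t

section ODE

variable {N : ℕ} {Q : ℝ → ℝ} {K : ℝ}

theorem intervalIntegrable_pow_mul_mul {u : ℝ → ℝ} (hQm : Measurable Q) (hQ0 : ∀ t, 0 ≤ Q t)
    (hQK : ∀ t, Q t ≤ K) (hu : Continuous u) (n : ℕ) (x y : ℝ) :
    IntervalIntegrable (fun t => t ^ n * Q t * u t) volume x y := by
  have h1 : IntervalIntegrable Q volume x y := by
    rw [intervalIntegrable_iff]
    refine Measure.integrableOn_of_bounded (M := K) (by simp) hQm.aestronglyMeasurable ?_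
    exact Eventually.of_forall fun t => by rw [Real.norm_of_nonneg (hQ0 t)]; exact hQK t
  have h2 := (h1.mul_continuousOn (g := fun t => t ^ n * u t) (by fun_prop))
  exact h2.congr (fun t _ => by ring)

theorem radialTerm_nonneg_of_nonneg (hQ0 : ∀ t, 0 ≤ Q t) (n : ℕ) (r : ℝ) :
    0 ≤ radialTerm N Q n r := by
  induction n generalizing r with
  | zero => simp [radialTerm]
  | succ n ih =>
    refine intervalIntegral.integral_nonneg (abs_nonneg r) fun s hs => ?_
    refine mul_nonneg (inv_nonneg.2 (pow_nonneg hs.1 _)) ?_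
    exact intervalIntegral.integral_nonneg hs.1 fun t ht =>
      mul_nonneg (mul_nonneg (pow_nonneg ht.1 _) (hQ0 t)) (ih t)

/-- The power `s^(N+1)` outweighs the singular weight `s^(-N)` of the outer integration and leaves a
factor `s`; this is what makes the Neumann series regular at the origin. -/
theorem inv_pow_mul_integral_le {u : ℝ → ℝ} (hQm : Measurable Q) (hQ0 : ∀ t, 0 ≤ Q t)
    (hQK : ∀ t, Q t ≤ K) (hu : Continuous u) {C s : ℝ} (hs : 0 ≤ s)
    (hC : ∀ t, 0 ≤ t → t ≤ s → u t ≤ C) (hu0 : ∀ t, 0 ≤ u t) :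
    ∫ t in (0 : ℝ)..s, t ^ N * Q t * u t ≤ s ^ (N + 1) * (K * C) := by
  have hK : 0 ≤ K := (hQ0 0).trans (hQK 0)
  have hC0 : 0 ≤ C := (hu0 0).trans (hC 0 le_rfl hs)
  have : ∫ t in (0 : ℝ)..s, t ^ N * Q t * u t ≤ ∫ t in (0 : ℝ)..s, s ^ N * (K * C) := by
    refine intervalIntegral.integral_mono_on hs
      (intervalIntegrable_pow_mul_mul hQm hQ0 hQK hu _ _ _) (by simp) fun t ht => ?_
    rw [mul_assoc]
    exact mul_le_mul (pow_le_pow_left₀ ht.1 ht.2 _)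
      (mul_le_mul (hQK t) (hC t ht.1 ht.2) (hu0 t) hK) (mul_nonneg (hQ0 t) (hu0 t))
      (pow_nonneg hs _)
  refine this.trans (le_of_eq ?_)
  simp
  ring

/-- Continuity and bound go through one induction: the continuity of a term makes the inner
integrand integrable, and its bound makes the weighted outer integrand integrable at `0`. Each
double integration gains a factor `K r² / (2(n+1))`; the `2` is discarded, which leaves an
exponential majorant. -/
theorem radialTerm_continuous_and_le (hQm : Measurable Q) (hQ0 : ∀ t, 0 ≤ Q t)
    (hQK : ∀ t, Q t ≤ K) (n : ℕ) :
    Continuous (radialTerm N Q n) ∧ ∀ r, radialTerm N Q n r ≤ (K * r ^ 2) ^ n / n.factorial := by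
  have hK : 0 ≤ K := (hQ0 0).trans (hQK 0)
  induction n with
  | zero => exact ⟨continuous_const, fun r => by simp [radialTerm]⟩
  | succ n ih =>
    obtain ⟨hc, hb⟩ := ih
    set f : ℝ → ℝ := fun s => (s ^ N)⁻¹ * ∫ t in (0 : ℝ)..s,
      t ^ N * Q t * radialTerm N Q n t with hf
    have hi : ∀ x y, IntervalIntegrable (fun t => t ^ N * Q t * radialTerm N Q n t) volume x y :=
      intervalIntegrable_pow_mul_mul hQm hQ0 hQK hc N
    have hfm : Measurable f :=
      ((measurable_id.pow_const N).inv).mul (intervalIntegral.continuous_primitive hi 0).measurable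
    have hfb : ∀ s, 0 ≤ s → f s ≤ K ^ (n + 1) / n.factorial * s ^ (2 * n + 1) := by
      intro s hs
      rcases hs.eq_or_lt with rfl | hs'
      · simp [hf]
      have := inv_pow_mul_integral_le (N := N) hQm hQ0 hQK hc hs
        (C := (K * s ^ 2) ^ n / n.factorial) (fun t ht hts => (hb t).trans (by gcongr))
        (radialTerm_nonneg_of_nonneg hQ0 n)
      calc f s ≤ (s ^ N)⁻¹ * (s ^ (N + 1) * (K * ((K * s ^ 2) ^ n / n.factorial))) := by
            simp only [hf]; gcongr
        _ = _ := by field_simp; ring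
    have hf0 : ∀ s, 0 ≤ s → 0 ≤ f s := fun s hs =>
      mul_nonneg (inv_nonneg.2 (pow_nonneg hs _)) (intervalIntegral.integral_nonneg hs fun t ht =>
        mul_nonneg (mul_nonneg (pow_nonneg ht.1 _) (hQ0 t)) (radialTerm_nonneg_of_nonneg hQ0 n t))
    have hfi : ∀ r, IntervalIntegrable f volume 0 |r| := by
      intro r
      have hg : IntervalIntegrable (fun s : ℝ => K ^ (n + 1) / n.factorial * s ^ (2 * n + 1))
        volume 0 |r| := (by fun_prop : Continuous _).intervalIntegrable _ _
      refine hg.mono_fun hfm.aestronglyMeasurable ?_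
      refine (ae_restrict_iff' measurableSet_uIoc).2 (Eventually.of_forall fun s hs => ?_)
      rw [Set.uIoc_of_le (abs_nonneg r)] at hs
      beta_reduce
      rw [Real.norm_of_nonneg (hf0 s hs.1.le), Real.norm_of_nonneg ((hf0 s hs.1.le).trans (hfb s hs.1.le))]
      exact hfb s hs.1.le
    constructor
    -- The bounds on `f` hold only for `s ≥ 0`, while continuity is wanted on all of `ℝ`: cut `f`
    -- off to `[0, ∞)`, take the primitive, and compose it with the absolute value.
    · have h1 : Continuous fun r => ∫ s in (0:ℝ)..r, (Set.Ici (0:ℝ)).indicator f s := by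
        refine intervalIntegral.continuous_primitive (fun x y => ?_) 0
        have key : ∀ z, IntervalIntegrable ((Set.Ici (0:ℝ)).indicator f) volume 0 z := by
          intro z
          rcases le_total 0 z with hz | hz
          · have := hfi z
            rw [abs_of_nonneg hz] at this
            refine this.congr fun s hs => ?_
            rw [Set.uIoc_of_le hz] at hs
            simp [hs.1.le]
          · have h0 : IntervalIntegrable (fun _ : ℝ => (0:ℝ)) volume z 0 := by simp
            refine (h0.congr_ae ?_).symm
            refine (ae_restrict_iff' measurableSet_uIoc).2 ?_
            have : ∀ᵐ s : ℝ, s ≠ 0 := by simp [ae_iff]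
            filter_upwards [this] with s hs0 hs
            rw [Set.uIoc_of_le hz] at hs
            have : ¬ (0 ≤ s) := not_le.2 (lt_of_le_of_ne hs.2 hs0)
            simp [this]
        exact (key x).symm.trans (key y)
      refine (h1.comp continuous_abs).congr fun r => ?_
      refine intervalIntegral.integral_congr fun s hs => ?_
      rw [Set.uIcc_of_le (abs_nonneg r)] at hs
      simp [hs.1, hf]
    · intro r
      calc radialTerm N Q (n + 1) r = ∫ s in (0 : ℝ)..|r|, f s := rfl
        _ ≤ ∫ s in (0 : ℝ)..|r|, K ^ (n + 1) / n.factorial * s ^ (2 * n + 1) :=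
          intervalIntegral.integral_mono_on (abs_nonneg r) (hfi r)
            ((by fun_prop : Continuous _).intervalIntegrable _ _) fun s hs => hfb s hs.1
        _ = K ^ (n + 1) / n.factorial * ((r ^ 2) ^ (n + 1) / (2 * (n + 1))) := by
          rw [intervalIntegral.integral_const_mul, integral_pow, ← sq_abs r]
          push_cast
          ring
        _ ≤ K ^ (n + 1) / n.factorial * ((r ^ 2) ^ (n + 1) / (n + 1)) := by
          gcongr; linarith
        _ = (K * r ^ 2) ^ (n + 1) / (n + 1).factorial := by
          rw [Nat.factorial_succ]; push_cast; field_simp; ring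

theorem radialTerm_continuous (hQm : Measurable Q) (hQ0 : ∀ t, 0 ≤ Q t)
    (hQK : ∀ t, Q t ≤ K) (n : ℕ) : Continuous (radialTerm N Q n) :=
  (radialTerm_continuous_and_le hQm hQ0 hQK n).1

theorem radialTerm_le (hQm : Measurable Q) (hQ0 : ∀ t, 0 ≤ Q t) (hQK : ∀ t, Q t ≤ K) (n : ℕ)
    (r : ℝ) : radialTerm N Q n r ≤ (K * r ^ 2) ^ n / n.factorial :=
  (radialTerm_continuous_and_le hQm hQ0 hQK n).2 r

theorem radialTerm_summable (hQm : Measurable Q) (hQ0 : ∀ t, 0 ≤ Q t) (hQK : ∀ t, Q t ≤ K)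
    (r : ℝ) : Summable fun n => radialTerm N Q n r :=
  Summable.of_nonneg_of_le (fun n => radialTerm_nonneg_of_nonneg hQ0 n r)
    (fun n => radialTerm_le hQm hQ0 hQK n r) (Real.summable_pow_div_factorial _)

theorem radialTerm_le_of_abs_le (hQm : Measurable Q) (hQ0 : ∀ t, 0 ≤ Q t) (hQK : ∀ t, Q t ≤ K)
    (n : ℕ) {r R : ℝ} (hr : |r| ≤ R) :
    ‖radialTerm N Q n r‖ ≤ (K * R ^ 2) ^ n / n.factorial := by
  have hK : 0 ≤ K := (hQ0 0).trans (hQK 0)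
  rw [Real.norm_of_nonneg (radialTerm_nonneg_of_nonneg hQ0 n r)]
  refine (radialTerm_le hQm hQ0 hQK n r).trans ?_
  have : r ^ 2 ≤ R ^ 2 := sq_le_sq.2 (hr.trans (le_abs_self R))
  gcongr

theorem radialSol_continuous (hQm : Measurable Q) (hQ0 : ∀ t, 0 ≤ Q t) (hQK : ∀ t, Q t ≤ K) :
    Continuous (radialSol N Q) := by
  refine continuous_iff_continuousAt.2 fun x => ?_
  have : ContinuousOn (radialSol N Q) (Set.Ioo (-(|x| + 1)) (|x| + 1)) :=
    continuousOn_tsum (fun n => (radialTerm_continuous hQm hQ0 hQK n).continuousOn)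
      (Real.summable_pow_div_factorial (K * (|x| + 1) ^ 2))
      fun n r hr => radialTerm_le_of_abs_le hQm hQ0 hQK n (abs_le.2 ⟨hr.1.le, hr.2.le⟩)
  refine this.continuousAt (Ioo_mem_nhds ?_ ?_)
  · linarith [neg_abs_le x]
  · linarith [le_abs_self x]

theorem radialFlux_eq_zero : radialFlux N Q 0 = 0 := by simp [radialFlux]

theorem radialSol_nonneg (hQ0 : ∀ t, 0 ≤ Q t) (r : ℝ) : 0 ≤ radialSol N Q r :=
  tsum_nonneg fun n => radialTerm_nonneg_of_nonneg hQ0 n r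

theorem radialFlux_nonneg (hQ0 : ∀ t, 0 ≤ Q t) {r : ℝ} (hr : 0 ≤ r) : 0 ≤ radialFlux N Q r :=
  intervalIntegral.integral_nonneg hr fun t ht =>
    mul_nonneg (mul_nonneg (pow_nonneg ht.1 _) (hQ0 t)) (radialSol_nonneg hQ0 t)

theorem hasSum_radialFlux (hQm : Measurable Q) (hQ0 : ∀ t, 0 ≤ Q t) (hQK : ∀ t, Q t ≤ K)
    {s : ℝ} (hs : 0 ≤ s) :
    HasSum (fun n => ∫ t in (0 : ℝ)..s, t ^ N * Q t * radialTerm N Q n t) (radialFlux N Q s) := by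
  have hK : 0 ≤ K := (hQ0 0).trans (hQK 0)
  refine intervalIntegral.hasSum_integral_of_dominated_convergence
    (fun n _ => s ^ N * K * ((K * s ^ 2) ^ n / n.factorial)) (fun n => ?_) (fun n => ?_) ?_ ?_ ?_
  · exact (((measurable_id.pow_const N).mul hQm).mul
      (radialTerm_continuous hQm hQ0 hQK n).measurable).aestronglyMeasurable
  · refine Eventually.of_forall fun t ht => ?_
    rw [Set.uIoc_of_le hs] at ht
    rw [norm_mul]
    refine mul_le_mul ?_ (radialTerm_le_of_abs_le hQm hQ0 hQK n ?_) (norm_nonneg _) (by positivity)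
    · rw [Real.norm_of_nonneg (mul_nonneg (pow_nonneg ht.1.le _) (hQ0 t))]
      exact mul_le_mul (pow_le_pow_left₀ ht.1.le ht.2 _) (hQK t) (hQ0 t) (pow_nonneg hs _)
    · rw [abs_of_pos ht.1]; exact ht.2
  · exact Eventually.of_forall fun t _ => (Real.summable_pow_div_factorial _).mul_left _
  · simp
  · exact Eventually.of_forall fun t _ => (radialTerm_summable hQm hQ0 hQK t).hasSum.mul_left _

theorem radialFlux_continuous (hQm : Measurable Q) (hQ0 : ∀ t, 0 ≤ Q t) (hQK : ∀ t, Q t ≤ K) :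
    Continuous (radialFlux N Q) :=
  intervalIntegral.continuous_primitive
    (intervalIntegrable_pow_mul_mul hQm hQ0 hQK (radialSol_continuous hQm hQ0 hQK) N) 0

theorem radialSol_le (hQm : Measurable Q) (hQ0 : ∀ t, 0 ≤ Q t) (hQK : ∀ t, Q t ≤ K)
    {r R : ℝ} (hr : |r| ≤ R) :
    radialSol N Q r ≤ ∑' n : ℕ, (K * R ^ 2) ^ n / n.factorial :=
  (radialTerm_summable hQm hQ0 hQK r).tsum_le_tsum
    (fun n => (le_abs_self _).trans (radialTerm_le_of_abs_le hQm hQ0 hQK n hr))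
    (Real.summable_pow_div_factorial _)

/-- The flux is bounded by a multiple of `r^(N+1)`, locally uniformly. -/
theorem exists_radialFlux_le (hQm : Measurable Q) (hQ0 : ∀ t, 0 ≤ Q t) (hQK : ∀ t, Q t ≤ K)
    (R : ℝ) : ∃ C, 0 ≤ C ∧ ∀ s, 0 ≤ s → s ≤ R → radialFlux N Q s ≤ C * s ^ (N + 1) := by
  have hK : 0 ≤ K := (hQ0 0).trans (hQK 0)
  refine ⟨K * ∑' n : ℕ, (K * R ^ 2) ^ n / n.factorial,
    mul_nonneg hK (tsum_nonneg fun n => by positivity), fun s hs hsR => ?_⟩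
  refine (inv_pow_mul_integral_le hQm hQ0 hQK (radialSol_continuous hQm hQ0 hQK) hs
    (fun t ht hts => radialSol_le hQm hQ0 hQK (R := R) ?_) (radialSol_nonneg hQ0)).trans
    (le_of_eq (mul_comm _ _))
  rw [abs_of_nonneg ht]; exact hts.trans hsR

/-- Summing the recursion for the terms under both integrals, by dominated convergence, gives the
twice integrated differential equation. -/
theorem radialSol_eq (hQm : Measurable Q) (hQ0 : ∀ t, 0 ≤ Q t) (hQK : ∀ t, Q t ≤ K) (r : ℝ) :
    radialSol N Q r = 1 + ∫ s in (0 : ℝ)..|r|, (s ^ N)⁻¹ * radialFlux N Q s := by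
  have hK : 0 ≤ K := (hQ0 0).trans (hQK 0)
  have h1 : HasSum (fun n => radialTerm N Q (n + 1) r)
      (∫ s in (0 : ℝ)..|r|, (s ^ N)⁻¹ * radialFlux N Q s) := by
    refine intervalIntegral.hasSum_integral_of_dominated_convergence
      (fun n _ => |r| * (K * ((K * |r| ^ 2) ^ n / n.factorial))) (fun n => ?_) (fun n => ?_) ?_ ?_ ?_
    · exact (((measurable_id.pow_const N).inv).mul (intervalIntegral.continuous_primitive
        (intervalIntegrable_pow_mul_mul hQm hQ0 hQK (radialTerm_continuous hQm hQ0 hQK n) N)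
        0).measurable).aestronglyMeasurable
    · refine Eventually.of_forall fun s hs => ?_
      rw [Set.uIoc_of_le (abs_nonneg r)] at hs
      have hs' := hs.1
      have h0 : 0 ≤ ∫ t in (0 : ℝ)..s, t ^ N * Q t * radialTerm N Q n t :=
        intervalIntegral.integral_nonneg hs.1.le fun t ht =>
          mul_nonneg (mul_nonneg (pow_nonneg ht.1 _) (hQ0 t)) (radialTerm_nonneg_of_nonneg hQ0 n t)
      rw [Real.norm_of_nonneg (mul_nonneg (by positivity) h0)]
      have := inv_pow_mul_integral_le (N := N) hQm hQ0 hQK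
        (radialTerm_continuous (N := N) hQm hQ0 hQK n) hs.1.le (C := (K * |r| ^ 2) ^ n / n.factorial)
        (fun t ht hts => (le_abs_self _).trans (radialTerm_le_of_abs_le hQm hQ0 hQK n
          (by rw [abs_of_nonneg ht]; exact hts.trans hs.2)))
        (radialTerm_nonneg_of_nonneg hQ0 n)
      calc _ ≤ (s ^ N)⁻¹ * (s ^ (N + 1) * (K * ((K * |r| ^ 2) ^ n / n.factorial))) := by gcongr
        _ = s * (K * ((K * |r| ^ 2) ^ n / n.factorial)) := by field_simp; ring
        _ ≤ _ := by
          have := hs.2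
          gcongr
    · exact Eventually.of_forall fun t _ =>
        ((Real.summable_pow_div_factorial _).mul_left _).mul_left _
    · simp
    · refine Eventually.of_forall fun s hs => ?_
      rw [Set.uIoc_of_le (abs_nonneg r)] at hs
      exact (hasSum_radialFlux hQm hQ0 hQK hs.1.le).mul_left _
  have h2 := (radialTerm_summable (N := N) hQm hQ0 hQK r).tsum_eq_zero_add
  rw [radialSol, h2, h1.tsum_eq]
  rfl

theorem radialSol_abs (r : ℝ) : radialSol N Q |r| = radialSol N Q r := by
  unfold radialSol
  congr 1
  ext n
  cases n <;> simp [radialTerm]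

theorem intervalIntegrable_radialFlux (hQm : Measurable Q) (hQ0 : ∀ t, 0 ≤ Q t)
    (hQK : ∀ t, Q t ≤ K) {x y : ℝ} (hx : 0 ≤ x) (hy : 0 ≤ y) :
    IntervalIntegrable (fun s => (s ^ N)⁻¹ * radialFlux N Q s) volume x y := by
  obtain ⟨C, hC0, hC⟩ := exists_radialFlux_le (N := N) hQm hQ0 hQK (max x y)
  have hg : IntervalIntegrable (fun s : ℝ => C * s) volume x y :=
    (by fun_prop : Continuous _).intervalIntegrable _ _
  refine hg.mono_fun (((measurable_id.pow_const N).inv).mul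
    (radialFlux_continuous hQm hQ0 hQK).measurable).aestronglyMeasurable ?_
  refine (ae_restrict_iff' measurableSet_uIoc).2 (Eventually.of_forall fun s hs => ?_)
  have hs0 : 0 < s := lt_of_le_of_lt (le_min hx hy) hs.1
  have := radialFlux_nonneg (N := N) hQ0 hs0.le
  beta_reduce
  rw [Real.norm_of_nonneg (by positivity), Real.norm_of_nonneg (by positivity)]
  calc _ ≤ (s ^ N)⁻¹ * (C * s ^ (N + 1)) := by gcongr; exact hC s hs0.le hs.2
    _ = C * s := by field_simp; ring

theorem radialSol_sub (hQm : Measurable Q) (hQ0 : ∀ t, 0 ≤ Q t) (hQK : ∀ t, Q t ≤ K) {x y : ℝ}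
    (hx : 0 ≤ x) (hy : 0 ≤ y) :
    radialSol N Q y - radialSol N Q x = ∫ s in x..y, (s ^ N)⁻¹ * radialFlux N Q s := by
  rw [radialSol_eq hQm hQ0 hQK x, radialSol_eq hQm hQ0 hQK y, abs_of_nonneg hx, abs_of_nonneg hy,
    add_sub_add_left_eq_sub, intervalIntegral.integral_interval_sub_left
      (intervalIntegrable_radialFlux hQm hQ0 hQK le_rfl hy)
      (intervalIntegrable_radialFlux hQm hQ0 hQK le_rfl hx)]

theorem radialSol_zero (hQm : Measurable Q) (hQ0 : ∀ t, 0 ≤ Q t) (hQK : ∀ t, Q t ≤ K) :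
    radialSol N Q 0 = 1 := by
  rw [radialSol_eq hQm hQ0 hQK 0]; simp

/-- The form of the maximum principle used here: `Q ≥ 0` makes the flux nonnegative. It yields `1 ≤
a` and, after normalisation, values in `[0, 1]` on the unit interval. -/
theorem radialSol_mono (hQm : Measurable Q) (hQ0 : ∀ t, 0 ≤ Q t) (hQK : ∀ t, Q t ≤ K) {x y : ℝ}
    (hx : 0 ≤ x) (hxy : x ≤ y) : radialSol N Q x ≤ radialSol N Q y := by
  rw [← sub_nonneg, radialSol_sub hQm hQ0 hQK hx (hx.trans hxy)]
  refine intervalIntegral.integral_nonneg hxy fun s hs => ?_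
  have hs0 := hx.trans hs.1
  exact mul_nonneg (by positivity) (radialFlux_nonneg hQ0 hs0)

theorem one_le_radialSol (hQm : Measurable Q) (hQ0 : ∀ t, 0 ≤ Q t) (hQK : ∀ t, Q t ≤ K) (r : ℝ) :
    1 ≤ radialSol N Q r := by
  rw [← radialSol_abs, ← radialSol_zero (N := N) hQm hQ0 hQK]
  exact radialSol_mono hQm hQ0 hQK le_rfl (abs_nonneg r)

theorem hasDerivAt_radialSol (hQm : Measurable Q) (hQ0 : ∀ t, 0 ≤ Q t) (hQK : ∀ t, Q t ≤ K) {r : ℝ}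
    (hr : 0 < r) : HasDerivAt (radialSol N Q) ((r ^ N)⁻¹ * radialFlux N Q r) r := by
  have hc : ContinuousAt (fun s => (s ^ N)⁻¹ * radialFlux N Q s) r :=
    ((continuousAt_id.pow N).inv₀ (by simp; intro h; exact absurd h hr.ne')).mul
      (radialFlux_continuous hQm hQ0 hQK).continuousAt
  have h1 := intervalIntegral.integral_hasDerivAt_right
    (intervalIntegrable_radialFlux hQm hQ0 hQK le_rfl hr.le)
    ((((measurable_id.pow_const N).inv).mul
      (radialFlux_continuous hQm hQ0 hQK).measurable).stronglyMeasurable.stronglyMeasurableAtFilter)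
    hc
  refine (h1.const_add 1).congr_of_eventuallyEq ?_
  filter_upwards [lt_mem_nhds hr] with s hs
  rw [radialSol_eq hQm hQ0 hQK s, abs_of_pos hs]

/-- `Q` is only bounded and measurable, so the second-order equation holds almost everywhere, by
Lebesgue differentiation. This is why the later identities are derived for absolutely continuous
functions. -/
theorem ae_hasDerivAt_radialFlux (hQm : Measurable Q) (hQ0 : ∀ t, 0 ≤ Q t) (hQK : ∀ t, Q t ≤ K) :
    ∀ᵐ r, HasDerivAt (radialFlux N Q) (r ^ N * Q r * radialSol N Q r) r := by
  have hi := intervalIntegrable_pow_mul_mul hQm hQ0 hQK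
    (radialSol_continuous (N := N) hQm hQ0 hQK) N
  have hloc : LocallyIntegrable (fun t => t ^ N * Q t * radialSol N Q t) volume := by
    intro x
    refine ⟨Set.Icc (x - 1) (x + 1), Icc_mem_nhds (by linarith) (by linarith), ?_⟩
    exact (intervalIntegrable_iff_integrableOn_Icc_of_le (by linarith)).1 (hi _ _)
  filter_upwards [_root_.LocallyIntegrable.ae_hasDerivAt_integral hloc] with r hr
  exact hr 0

theorem absolutelyContinuous_radialFlux (hQm : Measurable Q) (hQ0 : ∀ t, 0 ≤ Q t)
    (hQK : ∀ t, Q t ≤ K) {x y : ℝ} (h0 : 0 ∈ Set.uIcc x y) :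
    AbsolutelyContinuousOnInterval (radialFlux N Q) x y :=
  (intervalIntegrable_pow_mul_mul hQm hQ0 hQK
    (radialSol_continuous hQm hQ0 hQK) N x y).absolutelyContinuousOnInterval_intervalIntegral h0

/-- The flux is `O(r^(N+1))`, so the derivative `r^(-N) · flux` is bounded up to the singular point
`0`, and the solution is Lipschitz. -/
theorem absolutelyContinuous_radialSol (hQm : Measurable Q) (hQ0 : ∀ t, 0 ≤ Q t)
    (hQK : ∀ t, Q t ≤ K) {y : ℝ} (hy : 0 ≤ y) :
    AbsolutelyContinuousOnInterval (radialSol N Q) 0 y := by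
  obtain ⟨C, hC0, hC⟩ := exists_radialFlux_le (N := N) hQm hQ0 hQK y
  have : LipschitzOnWith (C * y).toNNReal (radialSol N Q) (Set.uIcc 0 y) := by
    rw [Set.uIcc_of_le hy]
    refine LipschitzOnWith.of_dist_le_mul fun s hs t ht => ?_
    rw [Real.dist_eq, radialSol_sub hQm hQ0 hQK ht.1 hs.1, Real.dist_eq,
      Real.coe_toNNReal _ (mul_nonneg hC0 hy), ← Real.norm_eq_abs]
    refine intervalIntegral.norm_integral_le_of_norm_le_const fun x hx => ?_
    have hx0 : 0 < x := lt_of_le_of_lt (le_min ht.1 hs.1) hx.1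
    have hxy : x ≤ y := hx.2.trans (max_le ht.2 hs.2)
    have := radialFlux_nonneg (N := N) hQ0 hx0.le
    rw [Real.norm_of_nonneg (by positivity)]
    calc _ ≤ (x ^ N)⁻¹ * (C * x ^ (N + 1)) := by gcongr; exact hC x hx0.le hxy
      _ = C * x := by field_simp; ring
      _ ≤ C * y := by gcongr
  exact this.absolutelyContinuousOnInterval

end ODE

/-! ### One-dimensional integral identities -/

/-- The fundamental theorem of calculus for absolutely continuous functions. The integrability of
`f'` is part of the conclusion, so the energy densities below need no separate integrability proof.
-/
theorem integral_eq_sub_of_ae_hasDerivAt {f f' : ℝ → ℝ} {a b : ℝ} (hab : a ≤ b)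
    (hf : AbsolutelyContinuousOnInterval f a b)
    (h : ∀ᵐ x, x ∈ Set.Ioc a b → HasDerivAt f (f' x) x) :
    IntervalIntegrable f' volume a b ∧ ∫ x in a..b, f' x = f b - f a := by
  have h1 : ∀ᵐ x ∂volume.restrict (Set.uIoc a b), deriv f x = f' x := by
    rw [ae_restrict_iff' measurableSet_uIoc, Set.uIoc_of_le hab]
    filter_upwards [h] with x hx hxm
    exact (hx hxm).deriv
  refine ⟨hf.intervalIntegrable_deriv.congr_ae h1, ?_⟩
  rw [← hf.integral_deriv_eq_sub]
  refine intervalIntegral.integral_congr_ae ?_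
  filter_upwards [h] with x hx hxm
  rw [Set.uIoc_of_le hab] at hxm
  exact (hx hxm).deriv.symm

/-- The regular solution normalised to be `1` at `r = 1`. -/
def normSol (N : ℕ) (Q : ℝ → ℝ) (r : ℝ) : ℝ := radialSol N Q r / radialSol N Q 1

/-- The flux of the normalised regular solution. -/
def normFlux (N : ℕ) (Q : ℝ → ℝ) (r : ℝ) : ℝ := radialFlux N Q r / radialSol N Q 1

section

variable {N : ℕ} {Q Q₁ Q₂ : ℝ → ℝ} {K : ℝ}

theorem normSol_one (hQm : Measurable Q) (hQ0 : ∀ t, 0 ≤ Q t) (hQK : ∀ t, Q t ≤ K) :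
    normSol N Q 1 = 1 :=
  div_self (zero_lt_one.trans_le (one_le_radialSol hQm hQ0 hQK 1)).ne'

theorem normFlux_zero : normFlux N Q 0 = 0 := by simp [normFlux, radialFlux_eq_zero]

theorem normSol_continuous (hQm : Measurable Q) (hQ0 : ∀ t, 0 ≤ Q t) (hQK : ∀ t, Q t ≤ K) :
    Continuous (normSol N Q) := (radialSol_continuous hQm hQ0 hQK).div_const _

theorem normSol_nonneg (hQ0 : ∀ t, 0 ≤ Q t) (r : ℝ) : 0 ≤ normSol N Q r :=
  div_nonneg (radialSol_nonneg hQ0 r) (radialSol_nonneg hQ0 1)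

theorem normSol_le_one (hQm : Measurable Q) (hQ0 : ∀ t, 0 ≤ Q t) (hQK : ∀ t, Q t ≤ K) {r : ℝ}
    (hr0 : 0 ≤ r) (hr : r ≤ 1) : normSol N Q r ≤ 1 :=
  (div_le_one (zero_lt_one.trans_le (one_le_radialSol hQm hQ0 hQK 1))).2
    (radialSol_mono hQm hQ0 hQK hr0 hr)

theorem hasDerivAt_normSol (hQm : Measurable Q) (hQ0 : ∀ t, 0 ≤ Q t) (hQK : ∀ t, Q t ≤ K) {r : ℝ}
    (hr : 0 < r) : HasDerivAt (normSol N Q) ((r ^ N)⁻¹ * normFlux N Q r) r := by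
  have := (hasDerivAt_radialSol (N := N) hQm hQ0 hQK hr).div_const (radialSol N Q 1)
  rwa [mul_div_assoc] at this

theorem ae_hasDerivAt_normFlux (hQm : Measurable Q) (hQ0 : ∀ t, 0 ≤ Q t) (hQK : ∀ t, Q t ≤ K) :
    ∀ᵐ r, HasDerivAt (normFlux N Q) (r ^ N * Q r * normSol N Q r) r := by
  filter_upwards [ae_hasDerivAt_radialFlux (N := N) hQm hQ0 hQK] with r hr
  have := hr.div_const (radialSol N Q 1)
  rwa [mul_div_assoc] at this

theorem absolutelyContinuous_normFlux (hQm : Measurable Q) (hQ0 : ∀ t, 0 ≤ Q t)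
    (hQK : ∀ t, Q t ≤ K) : AbsolutelyContinuousOnInterval (normFlux N Q) 0 1 := by
  have h : normFlux N Q = fun r => (radialSol N Q 1)⁻¹ * radialFlux N Q r := by
    ext r; rw [normFlux, div_eq_inv_mul]
  rw [h]
  exact (absolutelyContinuous_radialFlux hQm hQ0 hQK (by simp)).const_mul _

theorem absolutelyContinuous_normSol (hQm : Measurable Q) (hQ0 : ∀ t, 0 ≤ Q t)
    (hQK : ∀ t, Q t ≤ K) : AbsolutelyContinuousOnInterval (normSol N Q) 0 1 := by
  have h : normSol N Q = fun r => (radialSol N Q 1)⁻¹ * radialSol N Q r := by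
    ext r; rw [normSol, div_eq_inv_mul]
  rw [h]
  exact (absolutelyContinuous_radialSol hQm hQ0 hQK zero_le_one).const_mul _

/-- Alessandrini's identity for the radial equation. -/
theorem normFlux_sub_normFlux (hm₁ : Measurable Q₁) (h0₁ : ∀ t, 0 ≤ Q₁ t) (hK₁ : ∀ t, Q₁ t ≤ K)
    (hm₂ : Measurable Q₂) (h0₂ : ∀ t, 0 ≤ Q₂ t) (hK₂ : ∀ t, Q₂ t ≤ K) :
    normFlux N Q₁ 1 - normFlux N Q₂ 1 =
      ∫ t in (0 : ℝ)..1, t ^ N * (Q₁ t - Q₂ t) * (normSol N Q₁ t * normSol N Q₂ t) := by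
  -- Differentiating this Wronskian, the two products of fluxes cancel and only the difference of
  -- the potentials survives.
  have hac : AbsolutelyContinuousOnInterval
      (fun t => normFlux N Q₁ t * normSol N Q₂ t - normFlux N Q₂ t * normSol N Q₁ t) 0 1 :=
    ((absolutelyContinuous_normFlux hm₁ h0₁ hK₁).fun_mul
      (absolutelyContinuous_normSol hm₂ h0₂ hK₂)).fun_sub
    ((absolutelyContinuous_normFlux hm₂ h0₂ hK₂).fun_mul
      (absolutelyContinuous_normSol hm₁ h0₁ hK₁))
  have := (integral_eq_sub_of_ae_hasDerivAt
    (f' := fun t => t ^ N * (Q₁ t - Q₂ t) * (normSol N Q₁ t * normSol N Q₂ t))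
    zero_le_one hac ?_).2
  · rw [this, normSol_one hm₁ h0₁ hK₁, normSol_one hm₂ h0₂ hK₂, normFlux_zero, normFlux_zero]
    ring
  · filter_upwards [ae_hasDerivAt_normFlux (N := N) hm₁ h0₁ hK₁,
      ae_hasDerivAt_normFlux (N := N) hm₂ h0₂ hK₂] with t h1 h2 ht
    have e1 := hasDerivAt_normSol (N := N) hm₁ h0₁ hK₁ ht.1
    have e2 := hasDerivAt_normSol (N := N) hm₂ h0₂ hK₂ ht.1
    exact ((h1.mul e2).sub (h2.mul e1)).congr_deriv (by ring)

theorem intervalIntegrable_pow_mul_sub_mul {u : ℝ → ℝ}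
    (hm₁ : Measurable Q₁) (h0₁ : ∀ t, 0 ≤ Q₁ t) (hK₁ : ∀ t, Q₁ t ≤ K)
    (hm₂ : Measurable Q₂) (h0₂ : ∀ t, 0 ≤ Q₂ t) (hK₂ : ∀ t, Q₂ t ≤ K) (hu : Continuous u)
    (n : ℕ) (x y : ℝ) :
    IntervalIntegrable (fun t => t ^ n * (Q₁ t - Q₂ t) * u t) volume x y :=
  ((intervalIntegrable_pow_mul_mul hm₁ h0₁ hK₁ hu n x y).sub
    (intervalIntegrable_pow_mul_mul hm₂ h0₂ hK₂ hu n x y)).congr fun t _ => by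
      ring

/-- The analytic core. By Alessandrini's identity the gap is `∫ J`, linear in `u = α - β`, and the
energy identity for `u` says that `-∫ J` is the energy `∫ t^(n+1) (u'² + Q₁ u²)`. Hardy's inequality
makes this energy coercive with constant `D`, and Young's inequality turns that into a bound
quadratic in `M`. The divisor `n + 2` is `1 / ∫ t^(n+1)` over `(0,1)`. -/
theorem abs_gap_le {n : ℕ} {m M : ℝ}
    (hm₁ : Measurable Q₁) (h0₁ : ∀ t, 0 ≤ Q₁ t) (hK₁ : ∀ t, Q₁ t ≤ K)
    (hm₂ : Measurable Q₂) (h0₂ : ∀ t, 0 ≤ Q₂ t) (hK₂ : ∀ t, Q₂ t ≤ K)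
    (hm : ∀ t, m ≤ Q₁ t) (hM : ∀ t, |Q₁ t - Q₂ t| ≤ M) (hD : 0 < ((n : ℝ) / 2) ^ 2 + m) :
    |normFlux (n + 1) Q₁ 1 - normFlux (n + 1) Q₂ 1 -
      ∫ t in (0 : ℝ)..1, t ^ (n + 1) * (Q₁ t - Q₂ t) * normSol (n + 1) Q₂ t ^ 2| ≤
      M ^ 2 / ((n + 2) * (((n : ℝ) / 2) ^ 2 + m)) := by
  set α := normSol (n + 1) Q₁ with hα
  set β := normSol (n + 1) Q₂ with hβ
  have cα : Continuous α := normSol_continuous hm₁ h0₁ hK₁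
  have cβ : Continuous β := normSol_continuous hm₂ h0₂ hK₂
  set D := ((n : ℝ) / 2) ^ 2 + m with hDdef
  set p : ℝ → ℝ := fun t => normFlux (n + 1) Q₁ t - normFlux (n + 1) Q₂ t with hp
  set u : ℝ → ℝ := fun t => α t - β t with hu
  set J : ℝ → ℝ := fun t => t ^ (n + 1) * (Q₁ t - Q₂ t) * (β t * u t) with hJ
  set I₁ : ℝ → ℝ := fun t => t ^ (n + 1) * Q₁ t * u t ^ 2 + J t + (t ^ (n + 1))⁻¹ * p t ^ 2 with hI₁
  set I₂ : ℝ → ℝ := fun t => 2 * u t * ((t ^ (n + 1))⁻¹ * p t) * t ^ n + u t ^ 2 * (n * t ^ (n - 1))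
    with hI₂
  have acp : AbsolutelyContinuousOnInterval p 0 1 :=
    (absolutelyContinuous_normFlux hm₁ h0₁ hK₁).fun_sub (absolutelyContinuous_normFlux hm₂ h0₂ hK₂)
  have acu : AbsolutelyContinuousOnInterval u 0 1 :=
    (absolutelyContinuous_normSol hm₁ h0₁ hK₁).fun_sub (absolutelyContinuous_normSol hm₂ h0₂ hK₂)
  have u1 : u 1 = 0 := by
    simp only [hu, hα, hβ, normSol_one hm₁ h0₁ hK₁, normSol_one hm₂ h0₂ hK₂, sub_self]
  have p0 : p 0 = 0 := by simp only [hp, normFlux_zero, sub_self]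
  have du : ∀ t, 0 < t → HasDerivAt u ((t ^ (n + 1))⁻¹ * p t) t := fun t ht => by
    exact ((hasDerivAt_normSol (N := n + 1) hm₁ h0₁ hK₁ ht).sub
      (hasDerivAt_normSol (N := n + 1) hm₂ h0₂ hK₂ ht)).congr_deriv (by simp only [hp]; ring)
  have dp : ∀ᵐ t, HasDerivAt p (t ^ (n + 1) * Q₁ t * u t + t ^ (n + 1) * (Q₁ t - Q₂ t) * β t) t := by
    filter_upwards [ae_hasDerivAt_normFlux (N := n + 1) hm₁ h0₁ hK₁,
      ae_hasDerivAt_normFlux (N := n + 1) hm₂ h0₂ hK₂] with t h1 h2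
    exact (h1.sub h2).congr_deriv (by simp only [hu, hα, hβ]; ring)
  -- Energy identity: `I₁` is the derivative of `p u`, which vanishes at `0` because `p` does and at
  -- `1` because `u` does.
  obtain ⟨i1, e1⟩ := integral_eq_sub_of_ae_hasDerivAt (f' := I₁) zero_le_one (acp.fun_mul acu) (by
    filter_upwards [dp] with t h1 ht
    exact (h1.mul (du t ht.1)).congr_deriv (by simp only [hI₁, hJ]; ring))
  have acpow : AbsolutelyContinuousOnInterval (fun t : ℝ => t ^ n) 0 1 :=
    ContDiffOn.absolutelyContinuousOnInterval (by fun_prop)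
  -- `I₂` is the derivative of `u² t^n`, the null Lagrangian that completes the square in Hardy's
  -- inequality.
  obtain ⟨i2, e2⟩ := integral_eq_sub_of_ae_hasDerivAt (f' := I₂) zero_le_one
    ((acu.fun_mul acu).fun_mul acpow) (by
    refine Eventually.of_forall fun t ht => ?_
    exact (((du t ht.1).mul (du t ht.1)).mul (hasDerivAt_pow n t)).congr_deriv
      (by simp only [hI₂, Pi.mul_apply]; ring))
  have iJ : IntervalIntegrable J volume 0 1 :=
    intervalIntegrable_pow_mul_sub_mul hm₁ h0₁ hK₁ hm₂ h0₂ hK₂ (cβ.mul (cα.sub cβ)) _ _ _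
  have eG : normFlux (n + 1) Q₁ 1 - normFlux (n + 1) Q₂ 1 -
      ∫ t in (0 : ℝ)..1, t ^ (n + 1) * (Q₁ t - Q₂ t) * β t ^ 2 = ∫ t in (0 : ℝ)..1, J t := by
    rw [normFlux_sub_normFlux hm₁ h0₁ hK₁ hm₂ h0₂ hK₂, ← intervalIntegral.integral_sub]
    · refine intervalIntegral.integral_congr fun t _ => ?_
      simp only [hJ, hu, ← hα, ← hβ]; ring
    · exact intervalIntegrable_pow_mul_sub_mul hm₁ h0₁ hK₁ hm₂ h0₂ hK₂ (cα.mul cβ) _ _ _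
    · exact intervalIntegrable_pow_mul_sub_mul hm₁ h0₁ hK₁ hm₂ h0₂ hK₂ (cβ.pow 2) _ _ _
  rw [eG]
  have e1' : ∫ t in (0 : ℝ)..1, I₁ t = 0 := by rw [e1, u1, p0]; ring
  -- At `0` either `t^n` vanishes or `n = 0`; in the latter case `u(0)` need not vanish, but the
  -- prefactor `n / 2` does.
  have e2' : (n : ℝ) / 2 * ∫ t in (0 : ℝ)..1, I₂ t = 0 := by
    rw [e2, u1]
    rcases n with _ | n <;> simp
  have hG0 : ∫ t in (0 : ℝ)..1, J t ≤ 0 := by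
    refine (intervalIntegral.integral_mono_on zero_le_one iJ i1 fun t ht => ?_).trans e1'.le
    have h0 := h0₁ t
    have ht0 := ht.1
    have : 0 ≤ t ^ (n + 1) * Q₁ t * u t ^ 2 + (t ^ (n + 1))⁻¹ * p t ^ 2 := by positivity
    simp only [hI₁]; linarith
  rw [abs_of_nonpos hG0]
  -- `I₁` and `I₂` contribute nothing after integration, so they may be added freely. `I₁` contains
  -- `J` once more, so the inequality needs `2J` to be absorbed by the square term `D u²`, which
  -- Hardy and `Q₁ ≥ m` supply.
  have hpt : ∀ t ∈ Set.Ioo (0 : ℝ) 1,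
      -J t ≤ t ^ (n + 1) * (M ^ 2 / D) + I₁ t + (n : ℝ) / 2 * I₂ t := by
    intro t ht
    have ht0 := ht.1
    have hardy : ((n : ℝ) / 2) ^ 2 * u t ^ 2 * t ^ (n + 1) ≤
        (t ^ (n + 1))⁻¹ * p t ^ 2 + (n : ℝ) / 2 * I₂ t := by
      simp only [hI₂]
      rcases n with _ | n
      · simp; positivity
      · have hs : 0 ≤ t ^ n * (t * ((t ^ (n + 1 + 1))⁻¹ * p t) + ((n + 1 : ℕ) : ℝ) / 2 * u t) ^ 2 := by
          positivity
        -- Hardy's inequality produces a weight two powers lower; on the unit interval that weight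
        -- is the larger one.
        have hle : ((n + 1 : ℕ) / 2 : ℝ) ^ 2 * u t ^ 2 * t ^ (n + 1 + 1) ≤
            ((n + 1 : ℕ) / 2 : ℝ) ^ 2 * u t ^ 2 * t ^ n := by
          refine mul_le_mul_of_nonneg_left ?_ (by positivity)
          exact pow_le_pow_of_le_one ht.1.le ht.2.le (by omega)
        refine hle.trans ?_
        have : (t ^ (n + 1 + 1))⁻¹ * p t ^ 2 + ((n + 1 : ℕ) : ℝ) / 2 *
            (2 * u t * ((t ^ (n + 1 + 1))⁻¹ * p t) * t ^ (n + 1) +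
              u t ^ 2 * ((n + 1 : ℕ) * t ^ (n + 1 - 1))) -
            ((n + 1 : ℕ) / 2 : ℝ) ^ 2 * u t ^ 2 * t ^ n =
            t ^ n * (t * ((t ^ (n + 1 + 1))⁻¹ * p t) + ((n + 1 : ℕ) : ℝ) / 2 * u t) ^ 2 := by
          rw [Nat.add_sub_cancel]
          field_simp
          ring
        linarith
    have hβ0 : 0 ≤ β t := normSol_nonneg h0₂ t
    have hβ1 : β t ≤ 1 := normSol_le_one hm₂ h0₂ hK₂ ht.1.le ht.2.le
    have hM0 : 0 ≤ M := (abs_nonneg _).trans (hM t)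
    have hb : |(Q₁ t - Q₂ t) * β t| ≤ M := by
      rw [abs_mul, abs_of_nonneg hβ0]
      exact (mul_le_mul (hM t) hβ1 hβ0 hM0).trans (by simp)
    have hpot : 0 ≤ 2 * ((Q₁ t - Q₂ t) * β t) * u t + M ^ 2 / D + D * u t ^ 2 := by
      set b := (Q₁ t - Q₂ t) * β t
      have h1 : b ^ 2 ≤ M ^ 2 := sq_le_sq' (abs_le.1 hb).1 (abs_le.1 hb).2
      have h2 : 2 * b * u t + b ^ 2 / D + D * u t ^ 2 = (b + D * u t) ^ 2 / D := by
        field_simp; ring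
      have h3 : b ^ 2 / D ≤ M ^ 2 / D := by gcongr
      have h4 : 0 ≤ (b + D * u t) ^ 2 / D := by positivity
      linarith
    have h5 := mul_nonneg (pow_nonneg ht0.le (n + 1)) hpot
    have h6 : 0 ≤ t ^ (n + 1) * (Q₁ t - m) * u t ^ 2 := by
      have := sub_nonneg.2 (hm t)
      positivity
    simp only [hI₁, hJ]
    simp only [hDdef] at h5 ⊢
    nlinarith [h5, h6, hardy]
  have := intervalIntegral.integral_mono_on_of_le_Ioo zero_le_one iJ.neg
    ((((by fun_prop : Continuous fun t : ℝ => t ^ (n + 1) * (M ^ 2 / D)).intervalIntegrable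
      0 1).add i1).add (i2.const_mul ((n : ℝ) / 2))) (by simpa using hpt)
  simp only [Pi.neg_apply] at this
  rw [intervalIntegral.integral_neg, intervalIntegral.integral_add _ (i2.const_mul _),
    intervalIntegral.integral_add _ i1, intervalIntegral.integral_const_mul, e1', e2'] at this
  · refine this.trans (le_of_eq ?_)
    simp
    field_simp
    ring
  · exact (by fun_prop : Continuous _).intervalIntegrable _ _
  · exact ((by fun_prop : Continuous fun t : ℝ => t ^ (n + 1) * (M ^ 2 / D)).intervalIntegrable
      0 1).add i1

end

/-! ### Polar coordinates -/

section Polar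

variable {d : ℕ} {E : Type*} [NormedAddCommGroup E] [NormedSpace ℝ E]

/-- The parametrisation of the punctured space by polar coordinates. -/
def polarMap (d : ℕ) (p : unitSphere d × Set.Ioi (0 : ℝ)) : Sp d := (p.2 : ℝ) • (p.1 : Sp d)

theorem polarMap_eq : polarMap d = Subtype.val ∘ (homeomorphUnitSphereProd (Sp d)).symm := by
  ext p
  simp [polarMap]

theorem measurableEmbedding_polarMap : MeasurableEmbedding (polarMap d) := by
  rw [polarMap_eq]
  exact (MeasurableEmbedding.subtype_coe (measurableSet_singleton _).compl).comp
    (Homeomorph.measurableEmbedding _)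

theorem measurePreserving_polarMap (hd : 0 < d) : MeasurePreserving (polarMap d)
    ((sphereMeasure d).prod (Measure.volumeIoiPow (d - 1))) volume := by
  have : Nonempty (Fin d) := ⟨⟨0, hd⟩⟩
  rw [polarMap_eq]
  have h := (volume : Measure (Sp d)).measurePreserving_homeomorphUnitSphereProd
  rw [finrank_euclideanSpace_fin] at h
  have h1 := h.symm (homeomorphUnitSphereProd (Sp d)).toMeasurableEquiv
  have h2 := measurePreserving_subtype_coe (μa := (volume : Measure (Sp d)))
    (measurableSet_singleton (0 : Sp d)).compl
  rw [restrict_compl_singleton] at h2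
  exact h2.comp h1

theorem ae_polar_iff (hd : 0 < d) {P : Sp d → Prop} :
    (∀ᵐ x, P x) ↔ ∀ᵐ p ∂(sphereMeasure d).prod (Measure.volumeIoiPow (d - 1)),
      P ((p.2 : ℝ) • (p.1 : Sp d)) := by
  rw [← (measurePreserving_polarMap hd).map_eq, measurableEmbedding_polarMap.ae_map_iff]
  rfl

theorem integral_volumeIoiPow (n : ℕ) (f : ℝ → E) :
    ∫ x : Set.Ioi (0 : ℝ), f x ∂Measure.volumeIoiPow n = ∫ r in Set.Ioi (0 : ℝ), r ^ n • f r := by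
  simp only [Measure.volumeIoiPow, ENNReal.ofReal]
  rw [integral_withDensity_eq_integral_smul,
    integral_subtype_comap measurableSet_Ioi fun a ↦ Real.toNNReal (a ^ n) • f a,
    setIntegral_congr_fun measurableSet_Ioi fun x hx ↦ ?_]
  · rw [NNReal.smul_def, Real.coe_toNNReal _ (pow_nonneg hx.out.le _)]
  · exact (measurable_subtype_coe.pow_const _).real_toNNReal

theorem integrable_volumeIoiPow_iff (n : ℕ) (f : ℝ → E) :
    Integrable (fun x : Set.Ioi (0 : ℝ) => f x) (Measure.volumeIoiPow n) ↔
      IntegrableOn (fun r => r ^ n • f r) (Set.Ioi (0 : ℝ)) := by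
  rw [integrableOn_iff_comap_subtypeVal measurableSet_Ioi, Measure.volumeIoiPow,
    integrable_withDensity_iff_integrable_smul', integrable_congr]
  · refine .of_forall ?_
    rintro ⟨x, hx : 0 < x⟩
    simp (disch := positivity) [ENNReal.toReal_ofReal]
  · fun_prop
  · simp

theorem integral_polar (hd : 0 < d) {F : Sp d → E} (hF : Integrable F) :
    IntegrableOn (fun r : ℝ => r ^ (d - 1) • ∫ y, F (r • (y : Sp d)) ∂sphereMeasure d)
      (Set.Ioi 0) ∧
    ∫ x, F x = ∫ r in Set.Ioi (0 : ℝ), r ^ (d - 1) • ∫ y, F (r • (y : Sp d)) ∂sphereMeasure d := by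
  have hi : Integrable (F ∘ polarMap d)
      ((sphereMeasure d).prod (Measure.volumeIoiPow (d - 1))) :=
    ((measurePreserving_polarMap hd).integrable_comp_emb measurableEmbedding_polarMap).2 hF
  constructor
  · rw [← integrable_volumeIoiPow_iff]
    exact hi.integral_prod_right
  · rw [← integral_volumeIoiPow, ← (measurePreserving_polarMap hd).integral_comp
      measurableEmbedding_polarMap]
    exact integral_prod_symm _ hi

theorem norm_smul_sphere {r : ℝ} (hr : 0 ≤ r) (y : unitSphere d) : ‖r • (y : Sp d)‖ = r := by
  rw [norm_smul, norm_eq_of_mem_sphere y, mul_one, Real.norm_of_nonneg hr]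

theorem setIntegral_ball_polar (hd : 0 < d) {F : Sp d → E} (hF : IntegrableOn F (unitBall d)) :
    IntervalIntegrable (fun r : ℝ => r ^ (d - 1) • ∫ y, F (r • (y : Sp d)) ∂sphereMeasure d)
      volume 0 1 ∧
    ∫ x in unitBall d, F x =
      ∫ r in (0 : ℝ)..1, r ^ (d - 1) • ∫ y, F (r • (y : Sp d)) ∂sphereMeasure d := by
  obtain ⟨h1, h2⟩ := integral_polar hd (hF.integrable_indicator measurableSet_ball)
  have key : ∀ r ∈ Set.Ioi (0 : ℝ), r ^ (d - 1) • ∫ y, (unitBall d).indicator F (r • (y : Sp d))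
      ∂sphereMeasure d = (Set.Iio (1 : ℝ)).indicator
        (fun r : ℝ => r ^ (d - 1) • ∫ y, F (r • (y : Sp d)) ∂sphereMeasure d) r := by
    intro r hr
    by_cases hr1 : r < 1
    · rw [Set.indicator_of_mem (by exact hr1)]
      congr 2
      ext y
      rw [Set.indicator_of_mem]
      simpa [norm_smul_sphere (le_of_lt hr)] using hr1
    · rw [Set.indicator_of_notMem (by exact hr1)]
      have : ∀ y : unitSphere d, (unitBall d).indicator F (r • (y : Sp d)) = 0 := fun y => by
        rw [Set.indicator_of_notMem]
        simpa [norm_smul_sphere (le_of_lt hr)] using hr1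
      simp [this]
  have hset : Set.Iio (1 : ℝ) ∩ Set.Ioi 0 = Set.Ioo 0 1 := by
    ext; simp [and_comm]
  constructor
  · rw [intervalIntegrable_iff_integrableOn_Ioo_of_le zero_le_one]
    have h3 := h1.congr_fun key measurableSet_Ioi
    rw [IntegrableOn, integrable_indicator_iff measurableSet_Iio, IntegrableOn,
      Measure.restrict_restrict measurableSet_Iio, hset] at h3
    exact h3
  · rw [← integral_indicator measurableSet_ball, h2, setIntegral_congr_fun measurableSet_Ioi key,
      integral_indicator measurableSet_Iio, Measure.restrict_restrict measurableSet_Iio,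
      intervalIntegral.integral_of_le zero_le_one, integral_Ioc_eq_integral_Ioo, hset]

theorem sphereMeasure_ne_zero (hd : 0 < d) : sphereMeasure d ≠ 0 := by
  have : Nonempty (Fin d) := ⟨⟨0, hd⟩⟩
  exact Measure.toSphere_ne_zero _

/-- A bounded radial potential has a bounded measurable radial profile. -/
theorem IsBoundedRadial.exists_profile (hd : 0 < d) {q : Sp d → ℝ} (hq : IsBoundedRadial q) :
    ∃ p : ℝ → ℝ, Measurable p ∧ (∀ r, |p r| ≤ supNorm q) ∧
      ∀ᵐ x ∂ballMeasure d, q x = p ‖x‖ := by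
  obtain ⟨q₀, hq₀⟩ := hq.radial
  set q' := hq.memLp.1.mk q with hq'
  have hq'm : Measurable q' := hq.memLp.1.stronglyMeasurable_mk.measurable
  have h1 : ∀ᵐ x : Sp d, x ∈ unitBall d → q' x = q₀ ‖x‖ := by
    rw [← ae_restrict_iff' measurableSet_ball]
    filter_upwards [hq₀, hq.memLp.1.ae_eq_mk] with x h h'
    rw [hq', ← h', h]
  rw [ae_polar_iff hd] at h1
  have h2 := Measure.ae_ae_of_ae_prod h1
  have : NeZero (sphereMeasure d) := ⟨sphereMeasure_ne_zero hd⟩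
  -- The given profile `q₀` need not be measurable. By Fubini some ray carries a measurable
  -- representative of `q` that agrees with `q₀` almost everywhere, and its restriction to this ray
  -- serves as the profile.
  obtain ⟨y, hy⟩ := h2.exists
  set p₀ : ℝ → ℝ := fun r => q' (r • (y : Sp d)) with hp₀
  have hp₀m : Measurable p₀ := hq'm.comp (by fun_prop)
  have h3 : ∀ᵐ x : Sp d, x ∈ unitBall d → q₀ ‖x‖ = p₀ ‖x‖ := by
    rw [ae_polar_iff hd]
    have := (Measure.quasiMeasurePreserving_snd (μ := sphereMeasure d)
      (ν := Measure.volumeIoiPow (d - 1))).ae hy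
    filter_upwards [this] with p hp hpb
    have e1 := norm_smul_sphere (le_of_lt p.2.2) p.1
    have e2 := norm_smul_sphere (le_of_lt p.2.2) y
    simp only [e1, e2, mem_ball_zero_iff] at hp hpb ⊢
    rw [hp₀, ← hp hpb]
  have h4 : ∀ᵐ x ∂ballMeasure d, |q x| ≤ supNorm q := by
    have := ae_le_eLpNormEssSup (f := q) (μ := ballMeasure d)
    filter_upwards [this] with x hx
    rw [← eLpNorm_exponent_top] at hx
    have := ENNReal.toReal_mono hq.memLp.2.ne hx
    simpa [supNorm] using this
  -- Truncating at `±‖q‖` changes nothing almost everywhere in the ball and makes the bound hold for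
  -- every `r`, so that `p - κ ≥ 0` everywhere.
  refine ⟨fun r => max (-supNorm q) (min (p₀ r) (supNorm q)),
    measurable_const.max (hp₀m.min measurable_const), fun r => ?_, ?_⟩
  · have h0 : 0 ≤ supNorm q := ENNReal.toReal_nonneg
    exact abs_le.2 ⟨le_max_left _ _, max_le (by linarith) (min_le_right _ _)⟩
  · have h3' := (ae_restrict_iff' measurableSet_ball).2 h3
    filter_upwards [hq₀, h3', h4] with x hx hx3 hx4
    rw [← hx3, ← hx, min_eq_left (abs_le.1 hx4).2, max_eq_right (abs_le.1 hx4).1]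

end Polar

/-! ### Gradients -/

section Gradient

variable {d : ℕ}

theorem HasGradientAt.mul_fun {f g : Sp d → ℝ} {f' g' x : Sp d} (hf : HasGradientAt f f' x)
    (hg : HasGradientAt g g' x) :
    HasGradientAt (fun z => f z * g z) (f x • g' + g x • f') x := by
  rw [hasGradientAt_iff_hasFDerivAt] at *
  exact (hf.mul hg).congr_fderiv (by simp)

theorem HasGradientAt.sub_fun {f g : Sp d → ℝ} {f' g' x : Sp d} (hf : HasGradientAt f f' x)
    (hg : HasGradientAt g g' x) : HasGradientAt (fun z => f z - g z) (f' - g') x := by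
  rw [hasGradientAt_iff_hasFDerivAt] at *
  exact (hf.sub hg).congr_fderiv (by simp)

theorem hasGradientAt_comp_norm {a : ℝ → ℝ} {a' : ℝ} {x : Sp d} (hx : x ≠ 0)
    (ha : HasDerivAt a a' ‖x‖) : HasGradientAt (fun z : Sp d => a ‖z‖) ((a' / ‖x‖) • x) x := by
  have hx' : ‖x‖ ≠ 0 := norm_ne_zero_iff.2 hx
  have h1 : HasFDerivAt (fun z : Sp d => ‖z‖) (‖x‖⁻¹ • innerSL ℝ x) x := by
    have h := (hasStrictFDerivAt_norm_sq x).hasFDerivAt.sqrt (by positivity)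
    simp only [Real.sqrt_sq (norm_nonneg _)] at h
    refine h.congr_fderiv ?_
    ext v
    simp
    field_simp
  rw [hasGradientAt_iff_hasFDerivAt]
  refine (ha.comp_hasFDerivAt x h1).congr_fderiv ?_
  ext v
  simp [div_eq_mul_inv, mul_assoc]

theorem gradient_eq_symm_fderiv (u : Sp d → ℝ) :
    gradient u = fun x => (InnerProductSpace.toDual ℝ (Sp d)).symm (fderiv ℝ u x) := rfl

theorem measurable_gradient (u : Sp d → ℝ) : Measurable (gradient u) := by
  rw [gradient_eq_symm_fderiv]
  exact (InnerProductSpace.toDual ℝ (Sp d)).symm.continuous.measurable.comp (measurable_fderiv ℝ u)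

theorem continuous_gradient {u : Sp d → ℝ} (hu : ContDiff ℝ ∞ u) : Continuous (gradient u) := by
  rw [gradient_eq_symm_fderiv]
  exact (InnerProductSpace.toDual ℝ (Sp d)).symm.continuous.comp
    (hu.continuous_fderiv (by simp))

theorem inner_gradient (u : Sp d → ℝ) (x v : Sp d) : inner ℝ v (gradient u x) = fderiv ℝ u x v := by
  rw [real_inner_comm, gradient_eq_symm_fderiv, InnerProductSpace.toDual_symm_apply]

theorem gradient_eq_zero_of_notMem_tsupport {u : Sp d → ℝ} {x : Sp d} (hx : x ∉ tsupport u) :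
    gradient u x = 0 := by
  have : fderiv ℝ u x = 0 := by
    by_contra h
    exact hx (support_fderiv_subset ℝ (f := u) h)
  simp [gradient_eq_symm_fderiv, this]

theorem ContDiff.differentiable_smooth {u : Sp d → ℝ} (hu : ContDiff ℝ ∞ u) :
    Differentiable ℝ u := hu.differentiable (by simp)

/-- A continuous function is bounded on the unit ball. -/
theorem exists_bound_unitBall {E : Type*} [NormedAddCommGroup E] {f : Sp d → E}
    (hf : Continuous f) : ∃ C, ∀ x ∈ unitBall d, ‖f x‖ ≤ C := by
  obtain ⟨C, hC⟩ := (isCompact_closedBall (0 : Sp d) 1).exists_bound_of_continuousOn hf.continuousOn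
  exact ⟨C, fun x hx => hC x (Metric.ball_subset_closedBall hx)⟩

instance : IsFiniteMeasure (ballMeasure d) :=
  ⟨by rw [Measure.restrict_apply_univ]; exact measure_ball_lt_top⟩

theorem memLp_unitBall {E : Type*} [NormedAddCommGroup E] {f : Sp d → E} {p : ℝ≥0∞} {C : ℝ}
    (hf : AEStronglyMeasurable f (ballMeasure d)) (hC : ∀ x ∈ unitBall d, ‖f x‖ ≤ C) :
    MemLp f p (ballMeasure d) :=
  MemLp.of_bound hf C ((ae_restrict_iff' measurableSet_ball).2 (Eventually.of_forall hC))

theorem Continuous.memLp_unitBall {E : Type*} [NormedAddCommGroup E] {f : Sp d → E} {p : ℝ≥0∞}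
    (hf : Continuous f) [SecondCountableTopologyEither (Sp d) E] : MemLp f p (ballMeasure d) := by
  obtain ⟨C, hC⟩ := exists_bound_unitBall hf
  exact RadialDtN.memLp_unitBall hf.aestronglyMeasurable hC

/-- Test functions vanish outside the ball, so both integrals extend to the whole space, where
integration by parts has no boundary term. The gradient of `u` is not required to be continuous,
only bounded in the ball. -/
theorem isH1_of_differentiable {u : Sp d → ℝ} (hu : Differentiable ℝ u) {C : ℝ}
    (hC : ∀ x ∈ unitBall d, ‖gradient u x‖ ≤ C) : IsH1 u (gradient u) where
  memLp := Continuous.memLp_unitBall hu.continuous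
  memLp_grad := memLp_unitBall (measurable_gradient u).aestronglyMeasurable hC
  weak_grad φ hφ := by
    have hφ0 : ∀ x, x ∉ unitBall d → φ x = 0 := fun x hx =>
      image_eq_zero_of_notMem_tsupport fun h => hx (hφ.support h)
    have hg0 : ∀ x, x ∉ unitBall d → gradient φ x = 0 := fun x hx =>
      gradient_eq_zero_of_notMem_tsupport fun h => hx (hφ.support h)
    have hgc := continuous_gradient hφ.smooth
    have hgs : HasCompactSupport (gradient φ) := by
      refine HasCompactSupport.intro hφ.compact fun x hx => gradient_eq_zero_of_notMem_tsupport hx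
    have i1 : Integrable fun x => u x • gradient φ x :=
      (hu.continuous.smul hgc).integrable_of_hasCompactSupport hgs.smul_left
    have i2 : Integrable fun x => φ x • gradient u x := by
      obtain ⟨D, hD⟩ := exists_bound_unitBall hφ.smooth.continuous
      have : IntegrableOn (fun x => φ x • gradient u x) (unitBall d) :=
        memLp_one_iff_integrable.1 (memLp_unitBall (C := D * C)
          (hφ.smooth.continuous.aestronglyMeasurable.smul
            (measurable_gradient u).aestronglyMeasurable) fun x hx => by
              rw [norm_smul]
              exact mul_le_mul (hD x hx) (hC x hx) (norm_nonneg _)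
                ((norm_nonneg _).trans (hD x hx)))
      rwa [integrableOn_iff_integrable_of_support_subset] at this
      intro x hx
      by_contra h
      exact hx (by simp [hφ0 x h])
    have i3 : Integrable fun x => u x * φ x :=
      (hu.continuous.mul hφ.smooth.continuous).integrable_of_hasCompactSupport
        hφ.compact.mul_left
    rw [setIntegral_eq_integral_of_forall_compl_eq_zero fun x hx => by rw [hg0 x hx, smul_zero],
      setIntegral_eq_integral_of_forall_compl_eq_zero fun x hx => by rw [hφ0 x hx, zero_smul]]
    refine ext_inner_left ℝ fun v => ?_
    rw [inner_neg_right, ← integral_inner i1, ← integral_inner i2]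
    simp only [real_inner_smul_right, inner_gradient]
    rw [integral_mul_fderiv_eq_neg_fderiv_mul_of_integrable _ _ i3 (fun x _ => hu x)
      (fun x _ => ContDiff.differentiable_smooth hφ.smooth x)]
    · simp only [mul_comm]
    · refine (i2.const_inner v).congr (Eventually.of_forall fun x => ?_)
      simp only [real_inner_smul_right, inner_gradient, mul_comm]
    · refine (i1.const_inner v).congr (Eventually.of_forall fun x => ?_)
      simp only [real_inner_smul_right, inner_gradient]

end Gradient

/-! ### Solid harmonics -/

section Harmonic

variable {d : ℕ}

/-- A smooth homogeneous function of degree `ℓ` which is harmonic in the weak sense. -/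
structure IsSolidHarmonic (ℓ : ℕ) (H : Sp d → ℝ) : Prop where
  smooth : ContDiff ℝ ∞ H
  homog : ∀ (r : ℝ) (x : Sp d), H (r • x) = r ^ ℓ * H x
  euler : ∀ x, inner ℝ x (gradient H x) = ℓ * H x
  harmonic : ∀ φ : Sp d → ℝ, ContDiff ℝ ∞ φ → HasCompactSupport φ →
    ∫ x, inner ℝ (gradient φ x) (gradient H x) = 0

/-- A polynomial as a function on Euclidean space. -/
def polyFun (P : MvPolynomial (Fin d) ℝ) (x : Sp d) : ℝ := MvPolynomial.eval (fun i => x i) P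

theorem hasGradientAt_polyFun (P : MvPolynomial (Fin d) ℝ) (x : Sp d) :
    HasGradientAt (polyFun P) (WithLp.toLp 2 fun i => polyFun (MvPolynomial.pderiv i P) x) x := by
  induction P using MvPolynomial.induction_on with
  | C a =>
    have : polyFun (MvPolynomial.C a : MvPolynomial (Fin d) ℝ) = fun _ => a := by
      ext x; simp [polyFun]
    rw [this]
    convert hasGradientAt_const x a using 1
    ext i; simp [polyFun]
  | add P Q hP hQ =>
    rw [hasGradientAt_iff_hasFDerivAt] at *
    have : polyFun (P + Q) = polyFun P + polyFun Q := by ext x; simp [polyFun]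
    rw [this]
    refine (hP.add hQ).congr_fderiv ?_
    rw [← map_add]
    congr 1
    ext i; simp [polyFun]
  | mul_X P j hP =>
    have hX : HasGradientAt (fun z : Sp d => z j) (EuclideanSpace.single j (1 : ℝ)) x := by
      rw [hasGradientAt_iff_hasFDerivAt]
      refine (EuclideanSpace.proj (𝕜 := ℝ) j : Sp d →L[ℝ] ℝ).hasFDerivAt.congr_fderiv ?_
      ext v
      simp [EuclideanSpace.inner_single_left]
    have : polyFun (P * MvPolynomial.X j) = fun z : Sp d => polyFun P z * z j := by
      ext x; simp [polyFun]
    rw [this]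
    convert HasGradientAt.mul_fun hP hX using 1
    ext i
    by_cases hij : i = j
    · subst hij
      simp [polyFun]
    · simp [polyFun, MvPolynomial.pderiv_X_of_ne (Ne.symm hij), hij]

theorem contDiff_polyFun (P : MvPolynomial (Fin d) ℝ) : ContDiff ℝ ∞ (polyFun P) := by
  induction P using MvPolynomial.induction_on with
  | C a =>
    have : polyFun (MvPolynomial.C a : MvPolynomial (Fin d) ℝ) = fun _ => a := by
      ext x; simp [polyFun]
    rw [this]; exact contDiff_const
  | add P Q hP hQ =>
    have : polyFun (P + Q) = polyFun P + polyFun Q := by ext x; simp [polyFun]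
    rw [this]; exact hP.add hQ
  | mul_X P j hP =>
    have : polyFun (P * MvPolynomial.X j) = fun z : Sp d => polyFun P z * z j := by
      ext x; simp [polyFun]
    rw [this]; exact hP.mul (EuclideanSpace.proj (𝕜 := ℝ) j).contDiff

theorem gradient_polyFun (P : MvPolynomial (Fin d) ℝ) (x : Sp d) :
    gradient (polyFun P) x = WithLp.toLp 2 fun i => polyFun (MvPolynomial.pderiv i P) x :=
  (hasGradientAt_polyFun P x).gradient

/-- Homogeneity is checked monomial by monomial, the radial derivative is Euler's identity, and weak
harmonicity is integration by parts in each coordinate followed by `ΔP = 0`. -/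
theorem isSolidHarmonic_polyFun {ℓ : ℕ} {P : MvPolynomial (Fin d) ℝ} (hP : P.IsHomogeneous ℓ)
    (hh : ∑ i, MvPolynomial.pderiv i (MvPolynomial.pderiv i P) = 0) :
    IsSolidHarmonic ℓ (polyFun P) where
  smooth := contDiff_polyFun P
  homog r x := by
    simp only [polyFun, MvPolynomial.eval_eq', Finset.mul_sum]
    refine Finset.sum_congr rfl fun m hm => ?_
    have hdeg := hP (MvPolynomial.mem_support_iff.1 hm)
    rw [Finsupp.weight_apply, Finsupp.sum_fintype _ _ (by simp)] at hdeg
    simp only [Pi.one_apply, smul_eq_mul, mul_one] at hdeg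
    simp only [PiLp.smul_apply, smul_eq_mul, mul_pow, Finset.prod_mul_distrib,
      Finset.prod_pow_eq_pow_sum, hdeg]
    ring
  euler x := by
    have := congrArg (MvPolynomial.eval fun i => x i) hP.sum_X_mul_pderiv
    rw [gradient_polyFun, PiLp.inner_apply]
    simpa [polyFun, mul_comm] using this
  harmonic φ hφ hs := by
    have h1 : ∀ x, inner ℝ (gradient φ x) (gradient (polyFun P) x) =
        ∑ i, polyFun (MvPolynomial.pderiv i P) x * fderiv ℝ φ x (EuclideanSpace.single i 1) := by
      intro x
      rw [gradient_polyFun, PiLp.inner_apply]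
      refine Finset.sum_congr rfl fun i _ => ?_
      rw [← inner_gradient φ x, EuclideanSpace.inner_single_left]
      simp
    have hd1 : Continuous (fderiv ℝ φ) := hφ.continuous_fderiv (by simp)
    have hcs : HasCompactSupport (fderiv ℝ φ) := hs.fderiv ℝ
    have i1 : ∀ i, Integrable fun x =>
        polyFun (MvPolynomial.pderiv i P) x * fderiv ℝ φ x (EuclideanSpace.single i 1) := by
      intro i
      refine Continuous.integrable_of_hasCompactSupport
        ((contDiff_polyFun _).continuous.mul (hd1.clm_apply continuous_const)) ?_
      refine HasCompactSupport.mul_left ?_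
      exact hcs.comp_left (g := fun L : Sp d →L[ℝ] ℝ => L (EuclideanSpace.single i 1)) rfl
    have h2 : ∀ i, ∫ x, polyFun (MvPolynomial.pderiv i P) x *
          fderiv ℝ φ x (EuclideanSpace.single i 1) =
        - ∫ x, polyFun (MvPolynomial.pderiv i (MvPolynomial.pderiv i P)) x * φ x := by
      intro i
      have e : ∀ x, fderiv ℝ (polyFun (MvPolynomial.pderiv i P)) x (EuclideanSpace.single i 1) =
          polyFun (MvPolynomial.pderiv i (MvPolynomial.pderiv i P)) x := fun x => by
        rw [← inner_gradient, EuclideanSpace.inner_single_left, gradient_polyFun]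
        simp
      rw [integral_mul_fderiv_eq_neg_fderiv_mul_of_integrable _ (i1 i) _
        (fun x _ => ContDiff.differentiable_smooth (contDiff_polyFun _) x)
        (fun x _ => ContDiff.differentiable_smooth hφ x)]
      · simp only [e]
      · simp only [e]
        exact ((contDiff_polyFun _).continuous.mul hφ.continuous).integrable_of_hasCompactSupport
          hs.mul_left
      · exact ((contDiff_polyFun _).continuous.mul hφ.continuous).integrable_of_hasCompactSupport
          hs.mul_left
    simp only [h1]
    rw [integral_finsetSum _ fun i _ => i1 i]
    simp only [h2, Finset.sum_neg_distrib]
    rw [← integral_finsetSum]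
    · have : ∀ x, ∑ i, polyFun (MvPolynomial.pderiv i (MvPolynomial.pderiv i P)) x * φ x = 0 := by
        intro x
        rw [← Finset.sum_mul]
        have := congrArg (MvPolynomial.eval fun i => x i) hh
        simp only [map_sum, map_zero] at this
        simp [polyFun, this]
      simp [this]
    · exact fun i _ => ((contDiff_polyFun _).continuous.mul
        hφ.continuous).integrable_of_hasCompactSupport hs.mul_left

end Harmonic

/-! ### Separated solutions `α(|x|) H(x)`: gradient and membership in `H^1`. -/

section RadialSolution

variable {d N : ℕ} {Q : ℝ → ℝ} {K : ℝ}

theorem normFlux_nonneg (hQ0 : ∀ t, 0 ≤ Q t) {r : ℝ} (hr : 0 ≤ r) : 0 ≤ normFlux N Q r :=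
  div_nonneg (radialFlux_nonneg hQ0 hr) (radialSol_nonneg hQ0 1)

theorem exists_normFlux_le (hQm : Measurable Q) (hQ0 : ∀ t, 0 ≤ Q t) (hQK : ∀ t, Q t ≤ K) :
    ∃ C, 0 ≤ C ∧ ∀ s, 0 ≤ s → s ≤ 1 → normFlux N Q s ≤ C * s ^ (N + 1) := by
  obtain ⟨C, hC0, hC⟩ := exists_radialFlux_le (N := N) hQm hQ0 hQK 1
  refine ⟨C, hC0, fun s hs hs1 => (div_le_self (radialFlux_nonneg hQ0 hs)
    (one_le_radialSol hQm hQ0 hQK 1)).trans (hC s hs hs1)⟩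

/-- Away from `0` this is the chain rule. At `0`, where the norm is not differentiable, the solution
differs from its central value by `O(|x|²)`, so its gradient is `0`, in agreement with the formula.
-/
theorem hasGradientAt_normSol (hQm : Measurable Q) (hQ0 : ∀ t, 0 ≤ Q t) (hQK : ∀ t, Q t ≤ K)
    (x : Sp d) : HasGradientAt (fun z : Sp d => normSol N Q ‖z‖)
      ((normFlux N Q ‖x‖ / ‖x‖ ^ (N + 1)) • x) x := by
  rcases eq_or_ne x 0 with rfl | hx
  · rw [smul_zero, hasGradientAt_iff_hasFDerivAt, map_zero]
    obtain ⟨C, hC0, hC⟩ := exists_radialFlux_le (N := N) hQm hQ0 hQK 1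
    have hO : (fun z : Sp d => radialSol N Q ‖z‖ - radialSol N Q 0) =O[𝓝 0]
        fun z => ‖z - 0‖ ^ 2 := by
      refine Asymptotics.IsBigO.of_bound C ?_
      filter_upwards [Metric.ball_mem_nhds (0 : Sp d) zero_lt_one] with z hz
      rw [mem_ball_zero_iff] at hz
      rw [radialSol_sub hQm hQ0 hQK le_rfl (norm_nonneg z)]
      have : ∀ s ∈ Set.uIoc 0 ‖z‖, ‖(s ^ N)⁻¹ * radialFlux N Q s‖ ≤ C * ‖z‖ := by
        intro s hs
        rw [Set.uIoc_of_le (norm_nonneg z)] at hs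
        have hs0 := hs.1
        have hf := radialFlux_nonneg (N := N) hQ0 hs0.le
        rw [Real.norm_of_nonneg (by positivity)]
        calc _ ≤ (s ^ N)⁻¹ * (C * s ^ (N + 1)) := by
              gcongr; exact hC s hs0.le (hs.2.trans hz.le)
          _ = C * s := by field_simp; ring
          _ ≤ C * ‖z‖ := by gcongr; exact hs.2
      refine (intervalIntegral.norm_integral_le_of_norm_le_const this).trans (le_of_eq ?_)
      simp
      ring
    have h0 : HasFDerivAt (fun z : Sp d => radialSol N Q ‖z‖ - radialSol N Q 0)
      (0 : Sp d →L[ℝ] ℝ) 0 := hO.hasFDerivAt (by norm_num)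
    have h2 := (h0.mul_const (radialSol N Q 1)⁻¹).add_const (normSol N Q 0)
    rw [smul_zero] at h2
    refine h2.congr_of_eventuallyEq (Eventually.of_forall fun z => ?_)
    simp only [normSol, div_eq_mul_inv]
    ring
  · have hx' : 0 < ‖x‖ := norm_pos_iff.2 hx
    have := hasGradientAt_comp_norm hx (hasDerivAt_normSol (N := N) hQm hQ0 hQK hx')
    convert this using 2
    field_simp
    ring

/-- The solution of the Dirichlet problem with a solid harmonic as boundary value. -/
def separatedSol (N : ℕ) (Q : ℝ → ℝ) (H : Sp d → ℝ) (x : Sp d) : ℝ := normSol N Q ‖x‖ * H x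

variable {ℓ : ℕ} {H : Sp d → ℝ}

theorem hasGradientAt_smooth {w : Sp d → ℝ} (hw : ContDiff ℝ ∞ w) (x : Sp d) :
    HasGradientAt w (gradient w x) x :=
  (ContDiff.differentiable_smooth hw x).hasGradientAt

theorem hasGradientAt_separatedSol (hQm : Measurable Q) (hQ0 : ∀ t, 0 ≤ Q t) (hQK : ∀ t, Q t ≤ K)
    (hH : ContDiff ℝ ∞ H) (x : Sp d) :
    HasGradientAt (separatedSol N Q H) (normSol N Q ‖x‖ • gradient H x +
      H x • ((normFlux N Q ‖x‖ / ‖x‖ ^ (N + 1)) • x)) x :=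
  HasGradientAt.mul_fun (hasGradientAt_normSol hQm hQ0 hQK x) (hasGradientAt_smooth hH x)

theorem exists_bound_gradient_separatedSol (hQm : Measurable Q) (hQ0 : ∀ t, 0 ≤ Q t)
    (hQK : ∀ t, Q t ≤ K) (hH : ContDiff ℝ ∞ H) :
    ∃ C, ∀ x ∈ unitBall d, ‖gradient (separatedSol N Q H) x‖ ≤ C := by
  obtain ⟨C, hC0, hC⟩ := exists_normFlux_le (N := N) hQm hQ0 hQK
  obtain ⟨A, hA⟩ := exists_bound_unitBall (continuous_gradient hH)
  obtain ⟨B, hB⟩ := exists_bound_unitBall hH.continuous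
  refine ⟨A + B * C, fun x hx => ?_⟩
  rw [(hasGradientAt_separatedSol hQm hQ0 hQK hH x).gradient]
  have hx1 : ‖x‖ < 1 := by simpa using hx
  have h1 : ‖normSol N Q ‖x‖‖ ≤ 1 := by
    rw [Real.norm_of_nonneg (normSol_nonneg hQ0 _)]
    exact normSol_le_one hQm hQ0 hQK (norm_nonneg x) hx1.le
  have h2 : ‖(normFlux N Q ‖x‖ / ‖x‖ ^ (N + 1)) • x‖ ≤ C := by
    rw [norm_smul, Real.norm_of_nonneg (div_nonneg (normFlux_nonneg hQ0 (norm_nonneg x))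
      (by positivity))]
    rcases eq_or_ne x 0 with rfl | hx0
    · simpa using hC0
    have hx0' : 0 < ‖x‖ := norm_pos_iff.2 hx0
    have : normFlux N Q ‖x‖ / ‖x‖ ^ (N + 1) ≤ C :=
      (div_le_iff₀ (by positivity)).2 (hC _ hx0'.le hx1.le)
    calc _ ≤ C * 1 := by gcongr
      _ = C := mul_one C
  refine (norm_add_le _ _).trans (add_le_add ?_ ?_)
  · rw [norm_smul]
    calc _ ≤ 1 * A := mul_le_mul h1 (hA x hx) (norm_nonneg _) zero_le_one
      _ = A := one_mul A
  · rw [norm_smul]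
    exact mul_le_mul (hB x hx) h2 (norm_nonneg _) ((norm_nonneg _).trans (hB x hx))

theorem differentiable_separatedSol (hQm : Measurable Q) (hQ0 : ∀ t, 0 ≤ Q t)
    (hQK : ∀ t, Q t ≤ K) (hH : ContDiff ℝ ∞ H) : Differentiable ℝ (separatedSol N Q H) :=
  fun x => (hasGradientAt_separatedSol hQm hQ0 hQK hH x).differentiableAt

theorem isH1_separatedSol (hQm : Measurable Q) (hQ0 : ∀ t, 0 ≤ Q t) (hQK : ∀ t, Q t ≤ K)
    (hH : ContDiff ℝ ∞ H) : IsH1 (separatedSol N Q H) (gradient (separatedSol N Q H)) := by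
  obtain ⟨C, hC⟩ := exists_bound_gradient_separatedSol (N := N) hQm hQ0 hQK hH
  exact isH1_of_differentiable (differentiable_separatedSol hQm hQ0 hQK hH) hC

end RadialSolution

/-! ### Integrals over spheres -/

section Sphere

variable {d : ℕ}

theorem continuous_sphereIntegral {f : ℝ → unitSphere d → ℝ} (hf : Continuous f.uncurry) :
    Continuous fun r => ∫ y, f r y ∂sphereMeasure d := by
  have := continuous_parametric_integral_of_continuous (μ := sphereMeasure d) hf isCompact_univ
  simpa using this

theorem integrable_sphere {f : unitSphere d → ℝ} (hf : Continuous f) :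
    Integrable f (sphereMeasure d) :=
  (hf.integrable_of_hasCompactSupport (HasCompactSupport.of_compactSpace f))

theorem hasDerivAt_sphereIntegral {g w : Sp d → ℝ} (hg : Continuous g) (hw : ContDiff ℝ ∞ w)
    (r : ℝ) : HasDerivAt (fun r => ∫ y : unitSphere d, g y * w (r • (y : Sp d)) ∂sphereMeasure d)
      (∫ y : unitSphere d, g y * inner ℝ (y : Sp d) (gradient w (r • (y : Sp d)))
        ∂sphereMeasure d) r := by
  have hgr := continuous_gradient hw
  have hwc := hw.continuous
  have hcont : Continuous fun p : ℝ × unitSphere d =>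
      g p.2 * inner ℝ (p.2 : Sp d) (gradient w (p.1 • (p.2 : Sp d))) := by fun_prop
  obtain ⟨C, hC⟩ := (((isCompact_Icc (a := r - 1) (b := r + 1)).prod
    (isCompact_univ (X := unitSphere d))).exists_bound_of_continuousOn hcont.continuousOn)
  refine (hasDerivAt_integral_of_dominated_loc_of_deriv_le (μ := sphereMeasure d) (bound := fun _ => C)
    (F := fun r y => g y * w (r • (y : Sp d)))
    (F' := fun r y => g y * inner ℝ (y : Sp d) (gradient w (r • (y : Sp d))))
    (Icc_mem_nhds (by linarith : r - 1 < r) (by linarith : r < r + 1))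
    (Eventually.of_forall fun s => ?_) ?_ ?_ ?_ (integrable_const C) ?_).2
  · exact (by fun_prop : Continuous _).aestronglyMeasurable
  · exact integrable_sphere (by fun_prop)
  · exact (by fun_prop : Continuous _).aestronglyMeasurable
  · exact Eventually.of_forall fun y s hs => hC (s, y) ⟨hs, Set.mem_univ _⟩
  · refine Eventually.of_forall fun y s _ => ?_
    have h1 : HasDerivAt (fun s : ℝ => s • (y : Sp d)) (y : Sp d) s := by
      simpa using (hasDerivAt_id s).smul_const (y : Sp d)
    have h2 := (ContDiff.differentiable_smooth hw (s • (y : Sp d))).hasFDerivAt.comp_hasDerivAt s h1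
    rw [inner_gradient]
    exact h2.const_mul _

/-- The pairing of a function on the unit sphere with the restriction of `w` to the sphere of
radius `r`. -/
def sphereMean (g w : Sp d → ℝ) (r : ℝ) : ℝ :=
  ∫ y : unitSphere d, g y * w (r • (y : Sp d)) ∂sphereMeasure d

/-- The derivative of `sphereMean`. -/
def sphereMeanDeriv (g w : Sp d → ℝ) (r : ℝ) : ℝ :=
  ∫ y : unitSphere d, g y * inner ℝ (y : Sp d) (gradient w (r • (y : Sp d))) ∂sphereMeasure d

/-- The integral of `∇ H · ∇ w` over the sphere of radius `r`, without the Jacobian. -/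
def sphereDirichlet (g w : Sp d → ℝ) (r : ℝ) : ℝ :=
  ∫ y : unitSphere d, inner ℝ (gradient g (r • (y : Sp d))) (gradient w (r • (y : Sp d)))
    ∂sphereMeasure d

theorem hasDerivAt_sphereMean {g w : Sp d → ℝ} (hg : Continuous g) (hw : ContDiff ℝ ∞ w) (r : ℝ) :
    HasDerivAt (sphereMean g w) (sphereMeanDeriv g w r) r := hasDerivAt_sphereIntegral hg hw r

theorem continuous_sphereMeanDeriv {g w : Sp d → ℝ} (hg : Continuous g) (hw : ContDiff ℝ ∞ w) :
    Continuous (sphereMeanDeriv g w) := by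
  have hgr := continuous_gradient hw
  exact continuous_sphereIntegral (f := fun r (y : unitSphere d) =>
    g y * inner ℝ (y : Sp d) (gradient w (r • (y : Sp d)))) (by fun_prop)

theorem continuous_sphereDirichlet {g w : Sp d → ℝ} (hg : ContDiff ℝ ∞ g) (hw : ContDiff ℝ ∞ w) :
    Continuous (sphereDirichlet g w) := by
  have hgr := continuous_gradient hw
  have hgr' := continuous_gradient hg
  exact continuous_sphereIntegral (f := fun r (y : unitSphere d) =>
    inner ℝ (gradient g (r • (y : Sp d))) (gradient w (r • (y : Sp d)))) (by fun_prop)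

/-- The norm fails to be smooth only at the origin, and there `η ∘ ‖·‖` is locally constant. -/
theorem contDiff_comp_norm {η : ℝ → ℝ} {δ : ℝ} (hη : ContDiff ℝ ∞ η) (hδ : 0 < δ)
    (h0 : ∀ r < δ, η r = η 0) : ContDiff ℝ ∞ fun x : Sp d => η ‖x‖ := by
  refine contDiff_iff_contDiffAt.2 fun x => ?_
  rcases eq_or_ne x 0 with rfl | hx
  · refine (contDiffAt_const (c := η 0)).congr_of_eventuallyEq ?_
    filter_upwards [Metric.ball_mem_nhds (0 : Sp d) hδ] with z hz
    exact h0 _ (by simpa using hz)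
  · exact hη.contDiffAt.comp x (contDiffAt_norm ℝ hx)

theorem gradient_comp_norm {η : ℝ → ℝ} (hη : ContDiff ℝ ∞ η) {x : Sp d} (hx : x ≠ 0) :
    HasGradientAt (fun z : Sp d => η ‖z‖) ((deriv η ‖x‖ / ‖x‖) • x) x :=
  hasGradientAt_comp_norm hx ((hη.differentiable (by simp)) _).hasDerivAt

/-- Green's formula for a solid harmonic on spheres, in differentiated form. -/
theorem ae_sphereDirichlet_eq (hd : 2 ≤ d) {ℓ : ℕ} {H w : Sp d → ℝ} (hH : IsSolidHarmonic ℓ H)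
    (hw : ContDiff ℝ ∞ w) :
    ∀ᵐ r : ℝ, r ∈ Set.Ioi (0 : ℝ) → r ^ (d - 1) * sphereDirichlet H w r =
      deriv (fun s => ℓ * s ^ (d - 2 + ℓ) * sphereMean H w s) r := by
  set U : ℝ → ℝ := fun s => ℓ * s ^ (d - 2 + ℓ) * sphereMean H w s with hU
  have hHc := hH.smooth.continuous
  have hUd : ∀ r, HasDerivAt U (ℓ * ((d - 2 + ℓ : ℕ) * r ^ (d - 2 + ℓ - 1)) * sphereMean H w r +
      ℓ * r ^ (d - 2 + ℓ) * sphereMeanDeriv H w r) r := fun r =>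
    (((hasDerivAt_pow _ r).const_mul (ℓ : ℝ)).mul (hasDerivAt_sphereMean hHc hw r))
  have hUc : Continuous (deriv U) := by
    have : deriv U = _ := funext fun r => (hUd r).deriv
    rw [this]
    have h1 : Continuous (sphereMean H w) := continuous_iff_continuousAt.2 fun r =>
      (hasDerivAt_sphereMean hHc hw r).continuousAt
    have h2 := continuous_sphereMeanDeriv hHc hw
    fun_prop
  have hZc : Continuous fun r : ℝ => r ^ (d - 1) * sphereDirichlet H w r := by
    have := continuous_sphereDirichlet hH.smooth hw
    fun_prop
  have key : ∀ᵐ r : ℝ, r ∈ Set.Ioi (0 : ℝ) →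
      r ^ (d - 1) * sphereDirichlet H w r - deriv U r = 0 := by
    refine isOpen_Ioi.ae_eq_zero_of_integral_contDiff_smul_eq_zero
      ((hZc.sub hUc).locallyIntegrable.locallyIntegrableOn _) fun η hη hηs hηt => ?_
    obtain ⟨δ, hδ, hδη⟩ : ∃ δ : ℝ, 0 < δ ∧ ∀ r < δ, η r = 0 := by
      have h0 : (0 : ℝ) ∉ tsupport η := fun h => lt_irrefl (0 : ℝ) (hηt h)
      have : (tsupport η)ᶜ ∈ 𝓝 (0 : ℝ) := (isClosed_tsupport η).isOpen_compl.mem_nhds h0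
      obtain ⟨δ, hδ, hb⟩ := Metric.mem_nhds_iff.1 this
      refine ⟨δ, hδ, fun r hr => ?_⟩
      refine image_eq_zero_of_notMem_tsupport fun h => ?_
      have hr0 : 0 < r := hηt h
      exact hb (by simpa [abs_of_pos hr0] using hr) h
    -- Test weak harmonicity of `H` with `η(|x|) w`. In polar coordinates, Euler's identity turns
    -- the term with `∇η` into `η' U`, so `∫ (η r^(d-1) ∫∇H·∇w + η' U) dr = 0`; as `η` is arbitrary,
    -- the first density is `U'`.
    set φ : Sp d → ℝ := fun x => η ‖x‖ * w x with hφ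
    have hηn : ContDiff ℝ ∞ fun x : Sp d => η ‖x‖ :=
      contDiff_comp_norm hη hδ fun r hr => by rw [hδη r hr, hδη 0 hδ]
    have hφc : ContDiff ℝ ∞ φ := hηn.mul hw
    have hφs : HasCompactSupport φ := by
      refine HasCompactSupport.mul_right ?_
      obtain ⟨R, hR⟩ := hηs.isCompact.isBounded.subset_closedBall 0
      refine HasCompactSupport.intro (isCompact_closedBall (0 : Sp d) R) fun x hx => ?_
      refine image_eq_zero_of_notMem_tsupport fun h => hx ?_
      simpa using hR h
    have h0 := hH.harmonic φ hφc hφs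
    have hint : Integrable fun x => inner ℝ (gradient φ x) (gradient H x) := by
      refine ((continuous_gradient hφc).inner
        (continuous_gradient hH.smooth)).integrable_of_hasCompactSupport ?_
      refine HasCompactSupport.intro hφs fun x hx => ?_
      rw [gradient_eq_zero_of_notMem_tsupport hx, inner_zero_left]
    rw [(integral_polar (by omega) hint).2] at h0
    have hpt : ∀ r ∈ Set.Ioi (0 : ℝ), r ^ (d - 1) • ∫ y : unitSphere d,
        inner ℝ (gradient φ (r • (y : Sp d))) (gradient H (r • (y : Sp d))) ∂sphereMeasure d =
        η r * (r ^ (d - 1) * sphereDirichlet H w r) + deriv η r * U r := by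
      intro r hr
      have hr0 : (0 : ℝ) < r := hr
      have e : ∀ y : unitSphere d,
          inner ℝ (gradient φ (r • (y : Sp d))) (gradient H (r • (y : Sp d))) =
          η r * inner ℝ (gradient H (r • (y : Sp d))) (gradient w (r • (y : Sp d))) +
          deriv η r / r * ℓ * r ^ ℓ * (H y * w (r • (y : Sp d))) := by
        intro y
        have hn := norm_smul_sphere hr0.le y
        have hne : r • (y : Sp d) ≠ 0 := norm_ne_zero_iff.1 (by rw [hn]; exact hr0.ne')
        rw [(HasGradientAt.mul_fun (gradient_comp_norm hη hne)
          (hasGradientAt_smooth hw (r • (y : Sp d)))).gradient, inner_add_left,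
          real_inner_smul_left, real_inner_smul_left, real_inner_smul_left, hH.euler, hH.homog, hn,
          real_inner_comm]
        ring
      simp only [e]
      have hgw := continuous_gradient hw
      have hgH := continuous_gradient hH.smooth
      have hwc := hw.continuous
      rw [integral_add (integrable_sphere (by fun_prop)) (integrable_sphere (by fun_prop)),
        integral_const_mul, integral_const_mul]
      simp only [hU, sphereDirichlet, sphereMean, smul_eq_mul]
      have h1 : d - 1 = d - 2 + 1 := by omega
      rw [h1, pow_add r (d - 2) ℓ]
      field_simp
      ring
    rw [setIntegral_congr_fun measurableSet_Ioi hpt] at h0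
    have hdη : Continuous (deriv η) := hη.continuous_deriv (by simp)
    have hUcont : Continuous U := continuous_iff_continuousAt.2 fun r => (hUd r).continuousAt
    have hηc := hη.continuous
    have hdηs : HasCompactSupport (deriv η) := hηs.deriv
    have i1 : Integrable fun r => η r * (r ^ (d - 1) * sphereDirichlet H w r) :=
      (hηc.mul hZc).integrable_of_hasCompactSupport hηs.mul_right
    have i2 : Integrable fun r => deriv η r * U r :=
      (hdη.mul hUcont).integrable_of_hasCompactSupport hdηs.mul_right
    have i3 : Integrable fun r => η r * deriv U r :=
      (hηc.mul hUc).integrable_of_hasCompactSupport hηs.mul_right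
    have i4 : Integrable fun r => η r * U r :=
      (hηc.mul hUcont).integrable_of_hasCompactSupport hηs.mul_right
    have hoff : ∀ r ∉ Set.Ioi (0 : ℝ), η r = 0 := fun r hr =>
      image_eq_zero_of_notMem_tsupport fun h => hr (hηt h)
    have hoff' : ∀ r ∉ Set.Ioi (0 : ℝ), deriv η r = 0 := fun r hr => by
      by_contra h
      exact hr (hηt (support_deriv_subset h))
    rw [setIntegral_eq_integral_of_forall_compl_eq_zero fun r hr => by
      rw [hoff r hr, hoff' r hr]; ring, integral_add i1 i2] at h0
    have hparts : ∫ r, η r * deriv U r = - ∫ r, deriv η r * U r :=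
      integral_mul_deriv_eq_deriv_mul_of_integrable
        (fun r _ => ((hη.differentiable (by simp)) r).hasDerivAt)
        (fun r _ => (hUd r).differentiableAt.hasDerivAt) i3 i2 i4
    simp only [smul_eq_mul, mul_sub]
    rw [integral_sub i1 i3, hparts]
    linarith
  filter_upwards [key] with r hr hr0
  exact sub_eq_zero.1 (hr hr0)

end Sphere

/-! ### The energy of a separated solution -/

section Energy

variable {d : ℕ} {Q : ℝ → ℝ} {K : ℝ}

theorem hasDerivAt_inv_pow (ℓ : ℕ) {r : ℝ} (hr : r ≠ 0) :
    HasDerivAt (fun s : ℝ => (s ^ ℓ)⁻¹) (-(ℓ * (r ^ (ℓ + 1))⁻¹)) r := by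
  refine ((hasDerivAt_pow ℓ r).inv (pow_ne_zero _ hr)).congr_deriv ?_
  rcases ℓ with _ | ℓ
  · simp
  · rw [Nat.add_sub_cancel]
    field_simp
    ring

theorem integrableOn_energy (hQm : Measurable Q) (hQ0 : ∀ t, 0 ≤ Q t)
    (hQK : ∀ t, Q t ≤ K) {v w : Sp d → ℝ} (hv : Differentiable ℝ v) (hw : ContDiff ℝ ∞ w)
    (hb : ∃ C, ∀ x ∈ unitBall d, ‖gradient v x‖ ≤ C) :
    IntegrableOn (fun x => inner ℝ (gradient v x) (gradient w x) + Q ‖x‖ * v x * w x)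
      (unitBall d) := by
  obtain ⟨C, hC⟩ := hb
  obtain ⟨D, hD⟩ := exists_bound_unitBall (continuous_gradient hw)
  obtain ⟨B, hB⟩ := exists_bound_unitBall (hv.continuous.mul hw.continuous)
  refine Integrable.add (μ := ballMeasure d) ?_ ?_
  · refine memLp_one_iff_integrable.1 (memLp_unitBall (C := C * D)
      ((measurable_gradient v).inner (measurable_gradient w)).aestronglyMeasurable fun x hx => ?_)
    exact (norm_inner_le_norm _ _).trans (mul_le_mul (hC x hx) (hD x hx) (norm_nonneg _)
      ((norm_nonneg _).trans (hC x hx)))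
  · refine memLp_one_iff_integrable.1 (memLp_unitBall (C := K * B) ?_ fun x hx => ?_)
    · exact (((hQm.comp measurable_norm).mul hv.continuous.measurable).mul
        hw.continuous.measurable).aestronglyMeasurable
    · rw [mul_assoc, norm_mul, Real.norm_of_nonneg (hQ0 _)]
      exact mul_le_mul (hQK _) (hB x hx) (norm_nonneg _) ((hQ0 0).trans (hQK 0))

/-- In polar coordinates the energy density has an explicit antiderivative, the flux of the
separated solution through the sphere of radius `r` paired with `w`. It tends to `0` at the origin,
and at `r = 1` it gives the factor `ℓ + α'(1)`. Thus Green's formula is obtained without a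
divergence theorem on the ball. -/
theorem energy_separatedSol (hd : 2 ≤ d) {ℓ : ℕ} {H w : Sp d → ℝ} (hH : IsSolidHarmonic ℓ H)
    (hw : ContDiff ℝ ∞ w) (hQm : Measurable Q) (hQ0 : ∀ t, 0 ≤ Q t) (hQK : ∀ t, Q t ≤ K) {N : ℕ}
    (hN : N = d - 1 + 2 * ℓ) :
    ∫ x in unitBall d, (inner ℝ (gradient (separatedSol N Q H) x) (gradient w x) +
      Q ‖x‖ * separatedSol N Q H x * w x) = (ℓ + normFlux N Q 1) * sphereMean H w 1 := by
  have hHc := hH.smooth.continuous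
  set α := normSol N Q with hα
  set p := normFlux N Q with hp
  set W := sphereMean H w with hW
  set W' := sphereMeanDeriv H w with hW'
  set U : ℝ → ℝ := fun s => ℓ * s ^ (d - 2 + ℓ) * W s with hU
  set F : ℝ → ℝ := fun r => r ^ (d - 1) • ∫ y : unitSphere d,
    (inner ℝ (gradient (separatedSol N Q H) (r • (y : Sp d))) (gradient w (r • (y : Sp d))) +
      Q ‖r • (y : Sp d)‖ * separatedSol N Q H (r • (y : Sp d)) * w (r • (y : Sp d)))
      ∂sphereMeasure d with hF
  obtain ⟨hFi, hFe⟩ := setIntegral_ball_polar (by omega : 0 < d)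
    (integrableOn_energy hQm hQ0 hQK (differentiable_separatedSol (N := N) hQm hQ0 hQK hH.smooth) hw
      (exists_bound_gradient_separatedSol hQm hQ0 hQK hH.smooth))
  rw [hFe]
  change IntervalIntegrable F volume 0 1 at hFi
  change ∫ r in (0 : ℝ)..1, F r = _
  -- The two summands are the contributions to this flux of the radial derivatives of `H` and of
  -- `α`. In `f'` the terms `α' U` and `p (r^(-ℓ))' W` cancel.
  set f : ℝ → ℝ := fun r => α r * U r + p r * (r ^ ℓ)⁻¹ * W r with hf
  have dW : ∀ r, HasDerivAt W (W' r) r := hasDerivAt_sphereMean hHc hw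
  have cW' : Continuous W' := continuous_sphereMeanDeriv hHc hw
  have cW : Continuous W := continuous_iff_continuousAt.2 fun r => (dW r).continuousAt
  have smW : ContDiff ℝ 1 W := by
    refine contDiff_one_iff_deriv.2 ⟨fun r => (dW r).differentiableAt, ?_⟩
    rwa [show deriv W = W' from funext fun r => (dW r).deriv]
  have smU : ContDiff ℝ 1 U := by fun_prop
  have hFf : ∀ᵐ r : ℝ, r ∈ Set.Ioc (0 : ℝ) 1 → HasDerivAt f (F r) r := by
    filter_upwards [ae_sphereDirichlet_eq hd hH hw, ae_hasDerivAt_normFlux (N := N) hQm hQ0 hQK]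
      with r h1 h2 hr
    have hr0 : 0 < r := hr.1
    have h1 := h1 hr0
    have dU : HasDerivAt U (deriv U r) r :=
      (smU.differentiable (by simp) r).hasDerivAt
    have hd' := ((hasDerivAt_normSol (N := N) hQm hQ0 hQK hr0).mul dU).add
      ((h2.mul (hasDerivAt_inv_pow ℓ hr0.ne')).mul (dW r))
    refine hd'.congr_deriv ?_
    have e : ∀ y : unitSphere d,
        inner ℝ (gradient (separatedSol N Q H) (r • (y : Sp d))) (gradient w (r • (y : Sp d))) +
        Q ‖r • (y : Sp d)‖ * separatedSol N Q H (r • (y : Sp d)) * w (r • (y : Sp d)) =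
        α r * inner ℝ (gradient H (r • (y : Sp d))) (gradient w (r • (y : Sp d))) +
        (p r / r ^ (N + 1) * r ^ (ℓ + 1)) *
          (H y * inner ℝ (y : Sp d) (gradient w (r • (y : Sp d)))) +
        (Q r * α r * r ^ ℓ) * (H y * w (r • (y : Sp d))) := by
      intro y
      have hn := norm_smul_sphere hr0.le y
      rw [(hasGradientAt_separatedSol hQm hQ0 hQK hH.smooth (r • (y : Sp d))).gradient,
        separatedSol, hn, inner_add_left, real_inner_smul_left, real_inner_smul_left,
        real_inner_smul_left, real_inner_smul_left, hH.homog]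
      ring
    simp only [hF, e]
    have hgw := continuous_gradient hw
    have hgH := continuous_gradient hH.smooth
    have hwc := hw.continuous
    rw [integral_add (integrable_sphere (by fun_prop)) (integrable_sphere (by fun_prop)),
      integral_add (integrable_sphere (by fun_prop)) (integrable_sphere (by fun_prop)),
      integral_const_mul, integral_const_mul, integral_const_mul]
    change _ = r ^ (d - 1) * (α r * sphereDirichlet H w r +
      p r / r ^ (N + 1) * r ^ (ℓ + 1) * W' r + Q r * α r * r ^ ℓ * W r)
    have h3 : deriv U r = r ^ (d - 1) * sphereDirichlet H w r := h1.symm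
    rw [h3]
    simp only [hU, Pi.mul_apply, hα, hp]
    have hNp : r ^ N = r ^ (d - 2) * r * (r ^ ℓ * r ^ ℓ) := by
      rw [hN, show d - 1 + 2 * ℓ = d - 2 + 1 + (ℓ + ℓ) by omega]
      ring
    rw [pow_succ r N, hNp, show d - 1 = d - 2 + 1 by omega]
    field_simp
    ring
  have hlim : Tendsto f (𝓝[>] 0) (𝓝 0) := by
    have l1 : Tendsto (fun r => α r * U r) (𝓝[>] 0) (𝓝 0) := by
      have hc : Continuous fun r => α r * U r := (normSol_continuous hQm hQ0 hQK).mul smU.continuous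
      have h0 : α 0 * U 0 = 0 := by
        rcases ℓ with _ | ℓ <;> simp [hU]
      have := hc.tendsto 0
      rw [h0] at this
      exact this.mono_left nhdsWithin_le_nhds
    have l2 : Tendsto (fun r => p r * (r ^ ℓ)⁻¹ * W r) (𝓝[>] 0) (𝓝 0) := by
      obtain ⟨C, hC0, hC⟩ := exists_normFlux_le (N := N) hQm hQ0 hQK
      have hb : Tendsto (fun r : ℝ => C * r ^ (ℓ + d) * |W r|) (𝓝[>] 0) (𝓝 0) := by
        have hc : Continuous fun r : ℝ => C * r ^ (ℓ + d) * |W r| := by fun_prop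
        have := hc.tendsto 0
        rw [zero_pow (by omega), mul_zero, zero_mul] at this
        exact this.mono_left nhdsWithin_le_nhds
      refine squeeze_zero_norm' ?_ hb
      filter_upwards [Ioo_mem_nhdsGT (zero_lt_one' ℝ)] with r hr
      have hr0 := hr.1
      rw [norm_mul, Real.norm_eq_abs (W r), Real.norm_of_nonneg (mul_nonneg
        (normFlux_nonneg hQ0 hr0.le) (by positivity))]
      refine mul_le_mul_of_nonneg_right ?_ (abs_nonneg _)
      calc p r * (r ^ ℓ)⁻¹ ≤ (C * r ^ (N + 1)) * (r ^ ℓ)⁻¹ := by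
            gcongr; exact hC r hr0.le hr.2.le
        _ = C * r ^ (ℓ + d) := by
          rw [show N + 1 = ℓ + d + ℓ by omega, pow_add r (ℓ + d) ℓ]
          field_simp
    simpa using l1.add l2
  -- The factor `r^(-ℓ)` is singular at `0`, so the fundamental theorem is applied on `[ε, 1]` and
  -- `ε → 0` is taken afterwards.
  have hFTC : ∀ ε ∈ Set.Ioo (0 : ℝ) 1, ∫ r in ε..1, F r = f 1 - f ε := by
    intro ε hε
    have hsub : Set.uIcc ε 1 ⊆ Set.uIcc 0 1 := by
      rw [Set.uIcc_of_le hε.2.le, Set.uIcc_of_le zero_le_one]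
      exact Set.Icc_subset_Icc_left hε.1.le
    have hac : AbsolutelyContinuousOnInterval f ε 1 := by
      have a1 := (absolutelyContinuous_normSol (N := N) hQm hQ0 hQK).mono hsub
      have a2 := (absolutelyContinuous_normFlux (N := N) hQm hQ0 hQK).mono hsub
      have a3 : AbsolutelyContinuousOnInterval U ε 1 :=
        smU.contDiffOn.absolutelyContinuousOnInterval
      have a4 : AbsolutelyContinuousOnInterval W ε 1 :=
        smW.contDiffOn.absolutelyContinuousOnInterval
      have a5 : AbsolutelyContinuousOnInterval (fun r : ℝ => (r ^ ℓ)⁻¹) ε 1 := by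
        refine ContDiffOn.absolutelyContinuousOnInterval
          (ContDiffOn.inv (by fun_prop) fun r hr => ?_)
        rw [Set.uIcc_of_le hε.2.le] at hr
        exact pow_ne_zero _ (hε.1.trans_le hr.1).ne'
      exact (a1.fun_mul a3).fun_add ((a2.fun_mul a5).fun_mul a4)
    refine (integral_eq_sub_of_ae_hasDerivAt hε.2.le hac ?_).2
    filter_upwards [hFf] with r h hr
    exact h ⟨hε.1.trans hr.1, hr.2⟩
  have hprim : Tendsto (fun ε => ∫ r in (1 : ℝ)..ε, F r) (𝓝[>] 0) (𝓝 (∫ r in (1 : ℝ)..0, F r)) := by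
    have := intervalIntegral.continuousOn_primitive_interval' hFi
      (Set.right_mem_uIcc : (1 : ℝ) ∈ Set.uIcc 0 1)
    have := this 0 Set.left_mem_uIcc
    rw [Set.uIcc_of_le zero_le_one] at this
    refine this.mono_left ?_
    rw [← nhdsWithin_Ioo_eq_nhdsGT (zero_lt_one' ℝ)]
    exact nhdsWithin_mono _ Set.Ioo_subset_Icc_self
  have hprim' : Tendsto (fun ε => ∫ r in (1 : ℝ)..ε, F r) (𝓝[>] 0) (𝓝 (0 - f 1)) := by
    refine (hlim.sub_const (f 1)).congr' ?_
    filter_upwards [Ioo_mem_nhdsGT (zero_lt_one' ℝ)] with ε hε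
    rw [intervalIntegral.integral_symm, hFTC ε hε]
    ring
  have := tendsto_nhds_unique hprim hprim'
  rw [intervalIntegral.integral_symm] at this
  have h1 : ∫ r in (0 : ℝ)..1, F r = f 1 := by linarith
  rw [h1]
  simp only [hf, hU, hα, normSol_one hQm hQ0 hQK, one_pow, inv_one]
  ring

end Energy

/-! ### Boundary values -/

section Boundary

/-- Cut off near both endpoints and mollify. Uniform boundedness with pointwise convergence is all
that dominated convergence needs, so the crude constant `3C` is enough. -/
theorem exists_smooth_approx {f : ℝ → ℝ} {C : ℝ} (hf : ContinuousOn f (Set.Ioo 0 1))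
    (hC : ∀ x ∈ Set.Ioo (0 : ℝ) 1, |f x| ≤ C) :
    ∃ η : ℕ → ℝ → ℝ, (∀ n, ContDiff ℝ ∞ (η n)) ∧
      (∀ n, ∃ δ > 0, ∀ x, x < δ ∨ 1 - δ < x → η n x = 0) ∧ (∀ n x, |η n x| ≤ 3 * C) ∧
      ∀ x ∈ Set.Ioo (0 : ℝ) 1, Tendsto (fun n => η n x) atTop (𝓝 (f x)) := by
  have hC0 : 0 ≤ C := (abs_nonneg _).trans (hC (1 / 2) (by norm_num))
  set δ : ℕ → ℝ := fun n => 1 / ((n : ℝ) + 1) with hδ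
  have hδ0 : ∀ n, 0 < δ n := fun n => by positivity
  have hδlim : Tendsto δ atTop (𝓝 0) := tendsto_one_div_add_atTop_nhds_zero_nat
  -- The cut-off margin is `2δ` and the mollification radius will be `δ`, so the result still
  -- vanishes within `δ` of the endpoints.
  set g : ℕ → ℝ → ℝ := fun n => (Set.Icc (2 * δ n) (1 - 2 * δ n)).indicator f with hg
  have hsub : ∀ n, Set.Icc (2 * δ n) (1 - 2 * δ n) ⊆ Set.Ioo 0 1 := fun n x hx =>
    ⟨by linarith [hx.1, hδ0 n], by linarith [hx.2, hδ0 n]⟩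
  have hgm : ∀ n, AEStronglyMeasurable (g n) volume := fun n =>
    (aestronglyMeasurable_indicator_iff measurableSet_Icc).2
      ((hf.mono (hsub n)).aestronglyMeasurable measurableSet_Icc)
  have hgC : ∀ n x, |g n x| ≤ C := fun n x => by
    by_cases hx : x ∈ Set.Icc (2 * δ n) (1 - 2 * δ n)
    · simp only [hg, Set.indicator_of_mem hx]; exact hC x (hsub n hx)
    · simp only [hg, Set.indicator_of_notMem hx, abs_zero]; exact hC0
  have hg0 : ∀ n x, (x < 2 * δ n ∨ 1 - 2 * δ n < x) → g n x = 0 := fun n x hx => by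
    refine Set.indicator_of_notMem (fun h => ?_) _
    rcases hx with hx | hx
    · exact absurd h.1 (not_le.2 hx)
    · exact absurd h.2 (not_le.2 hx)
  set φ : ℕ → ContDiffBump (0 : ℝ) := fun n => ⟨δ n / 2, δ n, by have := hδ0 n; positivity,
    by have := hδ0 n; linarith⟩ with hφ
  set η : ℕ → ℝ → ℝ := fun n =>
    MeasureTheory.convolution ((φ n).normed volume) (g n) (ContinuousLinearMap.lsmul ℝ ℝ) volume
    with hη
  refine ⟨η, fun n => ?_, fun n => ⟨δ n, hδ0 n, fun x hx => ?_⟩, fun n x => ?_, fun x hx => ?_⟩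
  · refine HasCompactSupport.contDiff_convolution_left _ (φ n).hasCompactSupport_normed
      (φ n).contDiff_normed ?_
    exact (memLp_top_of_bound (hgm n) C (Eventually.of_forall (hgC n))).locallyIntegrable le_top
  · have hz : ∀ y ∈ Metric.ball x (φ n).rOut, g n y = 0 := fun y hy => by
      have hy' : |y - x| < δ n := by simpa [Real.dist_eq] using hy
      obtain ⟨h1, h2⟩ := abs_lt.1 hy'
      refine hg0 n y ?_
      rcases hx with hx | hx
      · left; linarith
      · right; linarith
    have hx0 : g n x = 0 := hz x (Metric.mem_ball_self (φ n).rOut_pos)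
    have := (φ n).normed_convolution_eq_right (μ := volume) (g := g n) (x₀ := x)
      fun y hy => by rw [hz y hy, hx0]
    exact this.trans hx0
  · have := (φ n).dist_normed_convolution_le (μ := volume) (g := g n) (x₀ := x) (ε := 2 * C)
      (hgm n) fun y _ => by
        rw [Real.dist_eq]
        calc |g n y - g n x| ≤ |g n y| + |g n x| := abs_sub _ _
          _ ≤ 2 * C := by linarith [hgC n y, hgC n x]
    rw [Real.dist_eq] at this
    have h2 : |η n x| ≤ |η n x - g n x| + |g n x| := by
      simpa using abs_add_le (η n x - g n x) (g n x)
    have h3 : |η n x - g n x| ≤ 2 * C := this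
    linarith [hgC n x]
  · refine ContDiffBump.convolution_tendsto_right (l := atTop) (k := fun _ => x) hδlim
      (Eventually.of_forall hgm) ?_ tendsto_const_nhds
    have h1 : Tendsto (fun p : ℕ × ℝ => f p.2) (atTop ×ˢ 𝓝 x) (𝓝 (f x)) :=
      ((hf.continuousAt (Ioo_mem_nhds hx.1 hx.2)).tendsto).comp tendsto_snd
    refine h1.congr' ?_
    set m := min x (1 - x) / 2 with hm
    have hm0 : 0 < m := half_pos (lt_min hx.1 (by linarith [hx.2]))
    have e1 : ∀ᶠ n in atTop, 2 * δ n < m := by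
      have : Tendsto (fun n => 2 * δ n) atTop (𝓝 (2 * 0)) := hδlim.const_mul 2
      rw [mul_zero] at this
      exact this.eventually_lt_const hm0
    filter_upwards [e1.prod_mk (Metric.ball_mem_nhds x hm0)] with p hp
    have hp2 : |p.2 - x| < m := by simpa [Real.dist_eq] using hp.2
    obtain ⟨h3, h4⟩ := abs_lt.1 hp2
    have h5 : min x (1 - x) ≤ x := min_le_left _ _
    have h6 : min x (1 - x) ≤ 1 - x := min_le_right _ _
    have hp1 := hp.1
    symm
    refine Set.indicator_of_mem ?_ f
    constructor <;> linarith

end Boundary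

/-! ### The separated solution minus the harmonic belongs to `H^1_0`. -/

section BoundaryValue

variable {d N : ℕ} {Q : ℝ → ℝ} {K : ℝ}

theorem tendsto_eLpNorm_two_zero {α E : Type*} [MeasurableSpace α] {μ : Measure α}
    [IsFiniteMeasure μ] [NormedAddCommGroup E]
    {F : ℕ → α → E} {C : ℝ} (hF : ∀ n, AEStronglyMeasurable (F n) μ)
    (hC : ∀ n, ∀ᵐ x ∂μ, ‖F n x‖ ≤ C)
    (hlim : ∀ᵐ x ∂μ, Tendsto (fun n => F n x) atTop (𝓝 0)) :
    Tendsto (fun n => eLpNorm (F n) 2 μ) atTop (𝓝 0) := by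
  have h : Tendsto (fun n => ∫⁻ x, ‖F n x‖ₑ ^ (2 : ℝ) ∂μ) atTop (𝓝 (∫⁻ _, 0 ∂μ)) := by
    refine tendsto_lintegral_of_dominated_convergence' (fun _ => ENNReal.ofReal C ^ (2 : ℝ))
      (fun n => (hF n).enorm.pow_const _) (fun n => ?_) ?_ ?_
    · filter_upwards [hC n] with x hx
      gcongr
      rw [← ofReal_norm]
      exact ENNReal.ofReal_le_ofReal hx
    · rw [lintegral_const]
      exact ENNReal.mul_ne_top (by simp) (measure_ne_top _ _)
    · filter_upwards [hlim] with x hx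
      have h1 : Tendsto (fun n => ‖F n x‖ₑ) atTop (𝓝 0) := by
        simpa using hx.enorm
      simpa [Function.comp_def] using
        (ENNReal.continuous_rpow_const (y := 2)).tendsto 0 |>.comp h1
  rw [lintegral_zero] at h
  have h2 := ((ENNReal.continuous_rpow_const (y := 1 / 2)).tendsto 0).comp h
  simp only [eLpNorm_eq_lintegral_rpow_enorm_toReal two_ne_zero ENNReal.ofNat_ne_top,
    ENNReal.toReal_ofNat]
  simpa [Function.comp_def] using h2

/-- Approximate the derivative of `α` by smooth functions vanishing near `0` and `1`, and integrate
from `1`. The primitives vanish near `1`, which gives compact support in the ball, and are constant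
near `0`, which gives smoothness at the origin. Dominated convergence handles both the functions and
their gradients. -/
theorem isH10_separatedSol_sub (hQm : Measurable Q) (hQ0 : ∀ t, 0 ≤ Q t) (hQK : ∀ t, Q t ≤ K)
    {H : Sp d → ℝ} (hH : ContDiff ℝ ∞ H) :
    IsH10 (fun x => separatedSol N Q H x - H x)
      (fun x => gradient (separatedSol N Q H) x - gradient H x) := by
  have hHc := hH.continuous
  have hgH := continuous_gradient hH
  obtain ⟨A, hA⟩ := exists_bound_unitBall hgH
  obtain ⟨B, hB⟩ := exists_bound_unitBall hHc
  have hdv := differentiable_separatedSol (N := N) hQm hQ0 hQK hH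
  have hgrad : ∀ x, HasGradientAt (fun x => separatedSol N Q H x - H x)
      (gradient (separatedSol N Q H) x - gradient H x) x := fun x =>
    HasGradientAt.sub_fun (hdv x).hasGradientAt (hasGradientAt_smooth hH x)
  refine ⟨?_, ?_⟩
  · have e : (fun x => gradient (separatedSol N Q H) x - gradient H x) =
        gradient (fun x => separatedSol N Q H x - H x) := funext fun x => (hgrad x).gradient.symm
    rw [e]
    obtain ⟨C, hC⟩ := exists_bound_gradient_separatedSol (N := N) hQm hQ0 hQK hH
    refine isH1_of_differentiable (fun x => (hgrad x).differentiableAt) (C := C + A)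
      fun x hx => ?_
    rw [(hgrad x).gradient]
    exact (norm_sub_le _ _).trans (add_le_add (hC x hx) (hA x hx))
  obtain ⟨C, hC0, hC⟩ := exists_normFlux_le (N := N) hQm hQ0 hQK
  set f : ℝ → ℝ := fun r => (r ^ N)⁻¹ * normFlux N Q r with hf
  have hfC : ∀ r ∈ Set.Ioo (0 : ℝ) 1, |f r| ≤ C := by
    intro r hr
    have hr0 := hr.1
    rw [abs_of_nonneg (mul_nonneg (by positivity) (normFlux_nonneg hQ0 hr0.le))]
    calc f r ≤ (r ^ N)⁻¹ * (C * r ^ (N + 1)) := by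
          simp only [hf]; gcongr; exact hC r hr0.le hr.2.le
      _ = C * r := by field_simp; ring
      _ ≤ C := mul_le_of_le_one_right hC0 hr.2.le
  have hfc : ContinuousOn f (Set.Ioo 0 1) := by
    refine ContinuousOn.mul (ContinuousOn.inv₀ (by fun_prop) fun r hr => pow_ne_zero _ hr.1.ne') ?_
    exact ((radialFlux_continuous hQm hQ0 hQK).div_const _).continuousOn
  have hfα : ∀ r ∈ Set.Icc (0 : ℝ) 1, normSol N Q r - 1 = ∫ s in (1 : ℝ)..r, f s := by
    intro r hr
    have h1 := normSol_one (N := N) hQm hQ0 hQK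
    rw [show normSol N Q r - 1 = normSol N Q r - normSol N Q 1 by rw [h1]]
    simp only [normSol, ← sub_div]
    rw [radialSol_sub hQm hQ0 hQK zero_le_one hr.1, ← intervalIntegral.integral_div]
    simp only [hf, normFlux, mul_div_assoc]
  obtain ⟨η, hηs, hηδ, hηC, hηlim⟩ := exists_smooth_approx hfc hfC
  set β : ℕ → ℝ → ℝ := fun n r => ∫ s in (1 : ℝ)..r, η n s with hβ
  have hβd : ∀ n r, HasDerivAt (β n) (η n r) r := fun n r =>
    intervalIntegral.integral_hasDerivAt_right ((hηs n).continuous.intervalIntegrable _ _)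
      ((hηs n).continuous.stronglyMeasurableAtFilter _ _) (hηs n).continuous.continuousAt
  have hβs : ∀ n, ContDiff ℝ ∞ (β n) := fun n => by
    rw [contDiff_infty_iff_deriv]
    refine ⟨fun r => (hβd n r).differentiableAt, ?_⟩
    rw [show deriv (β n) = η n from funext fun r => (hβd n r).deriv]
    exact hηs n
  have hβ1 : ∀ n δ, (∀ x, x < δ ∨ 1 - δ < x → η n x = 0) → 0 < δ → ∀ r, 1 - δ < r → β n r = 0 := by
    intro n δ h hδ r hr
    refine intervalIntegral.integral_zero_ae (Eventually.of_forall fun s hs => h s (Or.inr ?_))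
    exact lt_of_lt_of_le (lt_min (by linarith) hr) hs.1.le
  have hβ0 : ∀ n δ, (∀ x, x < δ ∨ 1 - δ < x → η n x = 0) → 0 < δ → ∀ r < δ, β n r = β n 0 := by
    intro n δ h hδ r hr
    have h1 : ∫ s in (0 : ℝ)..r, η n s = 0 :=
      intervalIntegral.integral_zero_ae (Eventually.of_forall fun s hs => h s (Or.inl
        (lt_of_le_of_lt hs.2 (max_lt hδ hr))))
    have := intervalIntegral.integral_add_adjacent_intervals (μ := volume) (f := η n) (a := 1)
      (b := 0) (c := r) ((hηs n).continuous.intervalIntegrable _ _)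
      ((hηs n).continuous.intervalIntegrable _ _)
    simp only [hβ]
    rw [← this, h1, add_zero]
  have hψ : ∀ n, ContDiff ℝ ∞ fun x : Sp d => β n ‖x‖ := fun n => by
    obtain ⟨δ, hδ, h⟩ := hηδ n
    exact contDiff_comp_norm (hβs n) hδ (hβ0 n δ h hδ)
  set φ : ℕ → Sp d → ℝ := fun n x => β n ‖x‖ * H x with hφ
  have hφs : ∀ n, ContDiff ℝ ∞ (φ n) := fun n => (hψ n).mul hH
  have htest : ∀ n, IsTestFunction (φ n) := fun n => by
    obtain ⟨δ, hδ, h⟩ := hηδ n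
    have hsupp : tsupport (φ n) ⊆ Metric.closedBall 0 (1 - δ) := by
      refine closure_minimal (fun x hx => ?_) Metric.isClosed_closedBall
      by_contra hx'
      refine hx ?_
      simp only [hφ]
      rw [hβ1 n δ h hδ ‖x‖ (by simpa using hx'), zero_mul]
    exact ⟨hφs n, (isCompact_closedBall _ _).of_isClosed_subset (isClosed_tsupport _) hsupp,
      hsupp.trans (Metric.closedBall_subset_ball (by linarith))⟩
  have hgφ : ∀ n x, x ≠ 0 → gradient (φ n) x = β n ‖x‖ • gradient H x +
      H x • ((η n ‖x‖ / ‖x‖) • x) := fun n x hx =>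
    (HasGradientAt.mul_fun (hasGradientAt_comp_norm hx (hβd n _))
      (hasGradientAt_smooth hH x)).gradient
  have hgv : ∀ x, x ≠ 0 → gradient (separatedSol N Q H) x = normSol N Q ‖x‖ • gradient H x +
      H x • ((f ‖x‖ / ‖x‖) • x) := fun x hx =>
    (HasGradientAt.mul_fun (hasGradientAt_comp_norm hx
      (hasDerivAt_normSol hQm hQ0 hQK (norm_pos_iff.2 hx))) (hasGradientAt_smooth hH x)).gradient
  have hβC : ∀ n, ∀ r ∈ Set.Icc (0 : ℝ) 1, |normSol N Q r - 1 - β n r| ≤ 1 + 3 * C := by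
    intro n r hr
    have h1 : |normSol N Q r - 1| ≤ 1 := by
      have e1 := normSol_nonneg (N := N) hQ0 r
      have e2 := normSol_le_one (N := N) hQm hQ0 hQK hr.1 hr.2
      exact abs_le.2 ⟨by linarith, by linarith⟩
    have h2 : |β n r| ≤ 3 * C := by
      have := intervalIntegral.norm_integral_le_of_norm_le_const (a := 1) (b := r) (f := η n)
        (C := 3 * C) fun x _ => hηC n x
      refine this.trans ?_
      have : |r - 1| ≤ 1 := abs_le.2 ⟨by linarith [hr.1], by linarith [hr.2]⟩
      exact mul_le_of_le_one_right (by positivity) this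
    exact (abs_sub _ _).trans (add_le_add h1 h2)
  have hβlim : ∀ r ∈ Set.Icc (0 : ℝ) 1,
      Tendsto (fun n => normSol N Q r - 1 - β n r) atTop (𝓝 0) := by
    intro r hr
    rw [hfα r hr]
    have : Tendsto (fun n => β n r) atTop (𝓝 (∫ s in (1 : ℝ)..r, f s)) := by
      refine intervalIntegral.tendsto_integral_filter_of_dominated_convergence (fun _ => 3 * C)
        (Eventually.of_forall fun n => (hηs n).continuous.aestronglyMeasurable)
        (Eventually.of_forall fun n => Eventually.of_forall fun s _ => hηC n s) (by simp) ?_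
      have hne : ∀ᵐ s : ℝ, s ≠ 1 := by simp [ae_iff]
      filter_upwards [hne] with s hs1 hs
      rw [Set.uIoc_of_ge hr.2] at hs
      exact hηlim s ⟨lt_of_le_of_lt hr.1 hs.1, lt_of_le_of_ne hs.2 hs1⟩
    simpa using this.const_sub (∫ s in (1 : ℝ)..r, f s)
  have hmem : ∀ᵐ x ∂ballMeasure d, x ∈ unitBall d := ae_restrict_mem measurableSet_ball
  refine ⟨φ, htest, ?_, ?_⟩
  · have e : ∀ n x, separatedSol N Q H x - H x - φ n x =
        (normSol N Q ‖x‖ - 1 - β n ‖x‖) * H x := fun n x => by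
      simp only [separatedSol, hφ]; ring
    simp only [e]
    refine tendsto_eLpNorm_two_zero (C := (1 + 3 * C) * B) (fun n => ?_) (fun n => ?_) ?_
    · have h1 := normSol_continuous (N := N) hQm hQ0 hQK
      have h2 := (hβs n).continuous
      exact (by fun_prop : Continuous _).aestronglyMeasurable
    · filter_upwards [hmem] with x hx
      have hx1 : ‖x‖ ∈ Set.Icc (0 : ℝ) 1 := ⟨norm_nonneg x, (mem_ball_zero_iff.1 hx).le⟩
      rw [norm_mul]
      exact mul_le_mul (hβC n _ hx1) (hB x hx) (norm_nonneg _) (by positivity)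
    · filter_upwards [hmem] with x hx
      have hx1 : ‖x‖ ∈ Set.Icc (0 : ℝ) 1 := ⟨norm_nonneg x, (mem_ball_zero_iff.1 hx).le⟩
      simpa using (hβlim _ hx1).mul_const (H x)
  -- For `d = 0` the space is a single point, which is not a null set, so the argument that ignores
  -- the origin requires `d > 0`.
  · rcases Nat.eq_zero_or_pos d with rfl | hd
    · have : ∀ n, (fun x => gradient (separatedSol N Q H) x - gradient H x - gradient (φ n) x) = 0 :=
        fun n => funext fun x => Subsingleton.elim _ _
      simp only [this, eLpNorm_zero]
      exact tendsto_const_nhds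
    have : Nonempty (Fin d) := ⟨⟨0, hd⟩⟩
    have hne : ∀ᵐ x ∂ballMeasure d, x ≠ 0 := ae_restrict_of_ae (by simp [ae_iff])
    have e : ∀ n x, x ≠ 0 → gradient (separatedSol N Q H) x - gradient H x - gradient (φ n) x =
        (normSol N Q ‖x‖ - 1 - β n ‖x‖) • gradient H x +
          ((f ‖x‖ - η n ‖x‖) * H x * ‖x‖⁻¹) • x := fun n x hx => by
      rw [hgφ n x hx, hgv x hx]
      module
    have hnorm : ∀ x : Sp d, ∀ c : ℝ, x ≠ 0 → ‖(c * H x * ‖x‖⁻¹) • x‖ = |c| * ‖H x‖ := by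
      intro x c hx
      have : ‖x‖ ≠ 0 := norm_ne_zero_iff.2 hx
      rw [norm_smul, norm_mul, norm_mul, norm_inv, norm_norm, Real.norm_eq_abs c]
      field_simp
    refine tendsto_eLpNorm_two_zero (C := (1 + 3 * C) * A + (C + 3 * C) * B)
      (fun n => ?_) (fun n => ?_) ?_
    · exact (((measurable_gradient _).sub (measurable_gradient _)).sub
        (measurable_gradient _)).aestronglyMeasurable
    · filter_upwards [hmem, hne] with x hx hx0
      have hx1 : ‖x‖ ∈ Set.Icc (0 : ℝ) 1 := ⟨norm_nonneg x, (mem_ball_zero_iff.1 hx).le⟩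
      have hx2 : ‖x‖ ∈ Set.Ioo (0 : ℝ) 1 := ⟨norm_pos_iff.2 hx0, mem_ball_zero_iff.1 hx⟩
      rw [e n x hx0]
      refine (norm_add_le _ _).trans (add_le_add ?_ ?_)
      · rw [norm_smul]
        exact mul_le_mul (hβC n _ hx1) (hA x hx) (norm_nonneg _) (by positivity)
      · rw [hnorm x _ hx0]
        refine mul_le_mul ?_ (hB x hx) (norm_nonneg _) (by positivity)
        exact (abs_sub _ _).trans (add_le_add (hfC _ hx2) (hηC n _))
    · filter_upwards [hmem, hne] with x hx hx0
      have hx1 : ‖x‖ ∈ Set.Icc (0 : ℝ) 1 := ⟨norm_nonneg x, (mem_ball_zero_iff.1 hx).le⟩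
      have hx2 : ‖x‖ ∈ Set.Ioo (0 : ℝ) 1 := ⟨norm_pos_iff.2 hx0, mem_ball_zero_iff.1 hx⟩
      simp only [e _ x hx0]
      have l1 := (hβlim _ hx1).smul_const (gradient H x)
      have l2 := ((((hηlim _ hx2).const_sub (f ‖x‖)).mul_const (H x)).mul_const ‖x‖⁻¹).smul_const x
      simpa using l1.add l2

end BoundaryValue

/-! ### Existence of the eigenvalues -/

section Existence

variable {d : ℕ}

/-- The potential `p - κ` on `[0, ∞)` associated with a radial profile `p`. -/
def shifted (p : ℝ → ℝ) (κ r : ℝ) : ℝ := p r - κ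

/-- The solution is `α(|x|) P(x)`: its energy against any smooth `w` is a boundary integral, which
vanishes for test functions (weak equation) and otherwise gives the normal derivative. -/
theorem isDtNEigenvalue_of_profile (hd : 2 ≤ d) {q : Sp d → ℝ} {p : ℝ → ℝ} {κ M : ℝ}
    (hpm : Measurable p) (hpM : ∀ r, |p r| ≤ M) (hκ : κ ≤ -M)
    (hqp : ∀ᵐ x ∂ballMeasure d, q x = p ‖x‖) (ℓ : ℕ) :
    IsDtNEigenvalue q κ ℓ (ℓ + normFlux (d - 1 + 2 * ℓ) (shifted p κ) 1) := by
  rintro Y ⟨P, hP, hharm, hY⟩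
  set N := d - 1 + 2 * ℓ with hN
  have hQm : Measurable (shifted p κ) := hpm.sub_const κ
  have hQ0 : ∀ t, 0 ≤ shifted p κ t := fun t => by
    have := (abs_le.1 (hpM t)).1
    simp only [shifted]; linarith
  have hQK : ∀ t, shifted p κ t ≤ M - κ := fun t => by
    have := (abs_le.1 (hpM t)).2
    simp only [shifted]; linarith
  have hH := isSolidHarmonic_polyFun hP hharm
  have hY' : ∀ y : unitSphere d, Y y = polyFun P (y : Sp d) := hY
  set v := separatedSol N (shifted p κ) (polyFun P) with hv
  have hen : ∀ w : Sp d → ℝ, ContDiff ℝ ∞ w → energy q κ v (gradient v) w =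
      (ℓ + normFlux N (shifted p κ) 1) * sphereMean (polyFun P) w 1 := by
    intro w hw
    rw [← energy_separatedSol hd hH hw hQm hQ0 hQK hN, energy]
    refine integral_congr_ae ?_
    filter_upwards [hqp] with x hx
    simp only [hx, shifted, hv]
  refine ⟨v, gradient v, ⟨isH1_separatedSol hQm hQ0 hQK hH.smooth,
    ⟨polyFun P, hH.smooth, fun y => (hY y).symm, isH10_separatedSol_sub hQm hQ0 hQK hH.smooth⟩,
    fun φ hφ => ?_⟩, ?_, fun w hw => ?_⟩
  · rw [hen φ hφ.smooth]
    have : ∀ y : unitSphere d, φ y = 0 := fun y =>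
      image_eq_zero_of_notMem_tsupport fun h => by
        have := hφ.support h
        simp at this
    simp [sphereMean, this]
  · have hc : Continuous fun y : unitSphere d => (ℓ + normFlux N (shifted p κ) 1) * Y y := by
      simp only [hY']
      have := hH.smooth.continuous
      fun_prop
    obtain ⟨C, hC⟩ := isCompact_univ.exists_bound_of_continuousOn hc.continuousOn
    exact MemLp.of_bound hc.aestronglyMeasurable C
      (Eventually.of_forall fun y => hC y (Set.mem_univ y))
  · rw [hen w hw, sphereMean, ← integral_const_mul]
    refine integral_congr_ae (Eventually.of_forall fun y => ?_)
    simp only [hY', one_smul]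
    ring

end Existence

/-! ### Uniqueness of the eigenvalues -/

section Uniqueness

theorem integrable_inner_of_memLp_two {α E : Type*} [MeasurableSpace α] {μ : Measure α}
    [NormedAddCommGroup E] [InnerProductSpace ℝ E] {f g : α → E} (hf : MemLp f 2 μ)
    (hg : MemLp g 2 μ) : Integrable (fun x => inner ℝ (f x) (g x)) μ := by
  refine (L2.integrable_inner (𝕜 := ℝ) (hf.toLp f) (hg.toLp g)).congr ?_
  filter_upwards [hf.coeFn_toLp, hg.coeFn_toLp] with x h1 h2
  rw [h1, h2]

theorem tendsto_integral_inner {α E : Type*} [MeasurableSpace α] {μ : Measure α}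
    [NormedAddCommGroup E] [InnerProductSpace ℝ E] {f g : α → E} {G : ℕ → α → E}
    (hf : MemLp f 2 μ) (hg : MemLp g 2 μ) (hG : ∀ n, MemLp (G n) 2 μ)
    (h : Tendsto (fun n => eLpNorm (fun x => g x - G n x) 2 μ) atTop (𝓝 0)) :
    Tendsto (fun n => ∫ x, inner ℝ (f x) (G n x) ∂μ) atTop (𝓝 (∫ x, inner ℝ (f x) (g x) ∂μ)) := by
  have e : ∀ k : α → E, ∀ hk : MemLp k 2 μ,
      ∫ x, inner ℝ (f x) (k x) ∂μ = inner ℝ (hf.toLp f) (hk.toLp k) := by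
    intro k hk
    rw [L2.inner_def]
    refine integral_congr_ae ?_
    filter_upwards [hf.coeFn_toLp, hk.coeFn_toLp] with x h1 h2
    rw [h1, h2]
  have hlim : Tendsto (fun n => (hG n).toLp (G n)) atTop (𝓝 (hg.toLp g)) := by
    rw [Lp.tendsto_Lp_iff_tendsto_eLpNorm'' _ hG _ hg]
    refine h.congr fun n => ?_
    rw [← eLpNorm_neg]
    congr 1
    ext x
    simp
  rw [e g hg]
  simp only [e _ (hG _)]
  exact tendsto_const_nhds.inner hlim

variable {d : ℕ}

/-- Green's formula is given for smooth `w` only. It extends to an `H^1` function `v₂` with boundary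
value `f` by approximation with `F + φ_n`, where `F` is a smooth extension of `f` and the `φ_n` are
test functions, so that the boundary integral is the same for all `n`. -/
theorem isDtN_pairing {q : Sp d → ℝ} (hq : MemLp q ∞ (ballMeasure d)) {κ : ℝ}
    {f g : unitSphere d → ℝ} {v₁ v₂ : Sp d → ℝ} {G₁ G₂ : Sp d → Sp d} (h₁ : IsH1 v₁ G₁)
    (hg : ∀ w : Sp d → ℝ, ContDiff ℝ ∞ w →
      energy q κ v₁ G₁ w = ∫ y : unitSphere d, g y * w y ∂sphereMeasure d)
    (h₂ : IsH1 v₂ G₂) (hb : HasBoundaryValue v₂ G₂ f) :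
    ∫ x in unitBall d, (inner ℝ (G₁ x) (G₂ x) + (q x - κ) * v₁ x * v₂ x) =
      ∫ y, g y * f y ∂sphereMeasure d := by
  obtain ⟨F, hF, hFf, hF0⟩ := hb
  obtain ⟨φ, hφ, hl1, hl2⟩ := hF0.approx
  set w : ℕ → Sp d → ℝ := fun n x => F x + φ n x with hw
  have hws : ∀ n, ContDiff ℝ ∞ (w n) := fun n => hF.add (hφ n).smooth
  have hwg : ∀ n x, gradient (w n) x = gradient F x + gradient (φ n) x := by
    intro n x
    simp only [gradient_eq_symm_fderiv, hw]
    rw [fderiv_fun_add (ContDiff.differentiable_smooth hF x)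
      (ContDiff.differentiable_smooth (hφ n).smooth x), map_add]
  have m1 : ∀ n, MemLp (w n) 2 (ballMeasure d) := fun n =>
    Continuous.memLp_unitBall (hws n).continuous
  have m2 : ∀ n, MemLp (gradient (w n)) 2 (ballMeasure d) := fun n =>
    Continuous.memLp_unitBall (continuous_gradient (hws n))
  have m3 : MemLp (fun x => (q x - κ) * v₁ x) 2 (ballMeasure d) :=
    MemLp.mul (p := ∞) (q := 2) h₁.memLp (hq.sub (memLp_const κ))
  have L1 := tendsto_integral_inner (G := w) m3 h₂.memLp m1 (by
    refine hl1.congr fun n => ?_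
    congr 1; ext x; simp only [hw]; ring)
  have L2 := tendsto_integral_inner (G := fun n => gradient (w n)) h₁.memLp_grad h₂.memLp_grad m2
    (by
      refine hl2.congr fun n => ?_
      congr 1; ext x; rw [hwg, sub_sub])
  have hsplit : ∀ (u : Sp d → ℝ) (U : Sp d → Sp d), MemLp u 2 (ballMeasure d) →
      MemLp U 2 (ballMeasure d) →
      ∫ x in unitBall d, (inner ℝ (G₁ x) (U x) + (q x - κ) * v₁ x * u x) =
        (∫ x in unitBall d, inner ℝ (G₁ x) (U x)) +
          ∫ x in unitBall d, inner ℝ ((q x - κ) * v₁ x) (u x) := by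
    intro u U hu hU
    rw [← integral_add (integrable_inner_of_memLp_two h₁.memLp_grad hU)
      (integrable_inner_of_memLp_two m3 hu)]
    refine integral_congr_ae (Eventually.of_forall fun x => ?_)
    simp only [RCLike.inner_apply, conj_trivial]
    ring
  have hE : ∀ n, energy q κ v₁ G₁ (w n) = ∫ y, g y * f y ∂sphereMeasure d := by
    intro n
    rw [hg _ (hws n)]
    refine integral_congr_ae (Eventually.of_forall fun y => ?_)
    have : φ n y = 0 := image_eq_zero_of_notMem_tsupport fun h => by
      have := (hφ n).support h
      simp at this
    simp only [hw, this, hFf, add_zero]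
  have L := L2.add L1
  simp only [← hsplit _ _ h₂.memLp h₂.memLp_grad, ← hsplit _ _ (m1 _) (m2 _)] at L
  refine tendsto_nhds_unique L ?_
  simp only [energy] at hE
  simp only [hE]
  exact tendsto_const_nhds

/-- Pair each of the two solutions with the other. The energy form is symmetric, so `a ∫ Y² = b ∫
Y²`. -/
theorem isDtN_smul_unique {q : Sp d → ℝ} (hq : MemLp q ∞ (ballMeasure d)) {κ : ℝ}
    {Y : unitSphere d → ℝ} {a b : ℝ} (ha : IsDtN q κ Y fun y => a * Y y)
    (hb : IsDtN q κ Y fun y => b * Y y) (hY : ∫ y, Y y * Y y ∂sphereMeasure d ≠ 0) : a = b := by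
  obtain ⟨v₁, G₁, s₁, -, e₁⟩ := ha
  obtain ⟨v₂, G₂, s₂, -, e₂⟩ := hb
  have p₁ := isDtN_pairing hq s₁.isH1 e₁ s₂.isH1 s₂.boundary
  have p₂ := isDtN_pairing hq s₂.isH1 e₂ s₁.isH1 s₁.boundary
  have hsymm : ∫ x in unitBall d, (inner ℝ (G₁ x) (G₂ x) + (q x - κ) * v₁ x * v₂ x) =
      ∫ x in unitBall d, (inner ℝ (G₂ x) (G₁ x) + (q x - κ) * v₂ x * v₁ x) := by
    refine integral_congr_ae (Eventually.of_forall fun x => ?_)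
    simp only [real_inner_comm]
    ring
  rw [hsymm, p₂] at p₁
  simp only [mul_assoc, integral_const_mul] at p₁
  exact (mul_right_cancel₀ hY p₁).symm

/-- The real and imaginary parts of `(X i + √-1 X j)^n`. -/
def planeHarmonic (i j : Fin d) : ℕ → MvPolynomial (Fin d) ℝ × MvPolynomial (Fin d) ℝ
  | 0 => (1, 0)
  | n + 1 => (MvPolynomial.X i * (planeHarmonic i j n).1 - MvPolynomial.X j * (planeHarmonic i j n).2,
      MvPolynomial.X i * (planeHarmonic i j n).2 + MvPolynomial.X j * (planeHarmonic i j n).1)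

theorem planeHarmonic_isHomogeneous (i j : Fin d) (n : ℕ) :
    (planeHarmonic i j n).1.IsHomogeneous n ∧ (planeHarmonic i j n).2.IsHomogeneous n := by
  induction n with
  | zero => exact ⟨MvPolynomial.isHomogeneous_one _ _, MvPolynomial.isHomogeneous_zero _ _ _⟩
  | succ n ih =>
    have hX := fun k : Fin d => MvPolynomial.isHomogeneous_X ℝ k
    simp only [planeHarmonic]
    rw [add_comm n 1]
    exact ⟨((hX i).mul ih.1).sub ((hX j).mul ih.2), ((hX i).mul ih.2).add ((hX j).mul ih.1)⟩

theorem pderiv_planeHarmonic_of_ne {i j k : Fin d} (hi : k ≠ i) (hj : k ≠ j) (n : ℕ) :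
    MvPolynomial.pderiv k (planeHarmonic i j n).1 = 0 ∧
      MvPolynomial.pderiv k (planeHarmonic i j n).2 = 0 := by
  induction n with
  | zero => simp [planeHarmonic]
  | succ n ih =>
    simp [planeHarmonic, ih.1, ih.2, MvPolynomial.pderiv_X_of_ne hi.symm,
      MvPolynomial.pderiv_X_of_ne hj.symm]

/-- With `z = x_i + √-1 x_j`, these are the Cauchy–Riemann relations `∂_i z^(n+1) = (n+1) z^n` and
`∂_j z^(n+1) = √-1 (n+1) z^n`. -/
theorem pderiv_planeHarmonic {i j : Fin d} (hij : i ≠ j) (n : ℕ) :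
    MvPolynomial.pderiv i (planeHarmonic i j (n + 1)).1 = (n + 1 : ℕ) * (planeHarmonic i j n).1 ∧
    MvPolynomial.pderiv i (planeHarmonic i j (n + 1)).2 = (n + 1 : ℕ) * (planeHarmonic i j n).2 ∧
    MvPolynomial.pderiv j (planeHarmonic i j (n + 1)).1 = -((n + 1 : ℕ) * (planeHarmonic i j n).2) ∧
    MvPolynomial.pderiv j (planeHarmonic i j (n + 1)).2 = (n + 1 : ℕ) * (planeHarmonic i j n).1 := by
  induction n with
  | zero =>
    simp [planeHarmonic, MvPolynomial.pderiv_X_of_ne hij, MvPolynomial.pderiv_X_of_ne hij.symm]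
  | succ n ih =>
    obtain ⟨h1, h2, h3, h4⟩ := ih
    rw [planeHarmonic]
    simp only [map_sub, map_add, Derivation.leibniz, h1, h2, h3, h4, MvPolynomial.pderiv_X_self,
      MvPolynomial.pderiv_X_of_ne hij, MvPolynomial.pderiv_X_of_ne hij.symm, smul_eq_mul]
    rw [planeHarmonic]
    push_cast
    refine ⟨?_, ?_, ?_, ?_⟩ <;> ring

theorem laplacian_planeHarmonic {i j : Fin d} (hij : i ≠ j) (n : ℕ) :
    ∑ k, MvPolynomial.pderiv k (MvPolynomial.pderiv k (planeHarmonic i j n).1) = 0 := by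
  rw [Finset.sum_eq_add i j hij (fun k _ hk => by
    rw [(pderiv_planeHarmonic_of_ne hk.1 hk.2 n).1, map_zero]) (by simp) (by simp)]
  rcases n with _ | _ | n
  · simp [planeHarmonic]
  · obtain ⟨h1, -, h3, -⟩ := pderiv_planeHarmonic hij 0
    rw [h1, h3]
    simp [planeHarmonic]
  · obtain ⟨h1, -, h3, -⟩ := pderiv_planeHarmonic hij (n + 1)
    obtain ⟨k1, -, -, k4⟩ := pderiv_planeHarmonic hij n
    rw [h1, h3]
    simp [k1, k4]

theorem eval_planeHarmonic {i j : Fin d} (hij : i ≠ j) (n : ℕ) :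
    MvPolynomial.eval (fun k => if k = i then (1 : ℝ) else 0) (planeHarmonic i j n).1 = 1 ∧
    MvPolynomial.eval (fun k => if k = i then (1 : ℝ) else 0) (planeHarmonic i j n).2 = 0 := by
  induction n with
  | zero => simp [planeHarmonic]
  | succ n ih => simp [planeHarmonic, ih.1, ih.2, hij.symm]

/-- Uniqueness of the eigenvalue would fail if every harmonic of degree `ℓ` were null. The real part
of `(x_1 + √-1 x_2)^ℓ` equals `1` at the first basis vector; two coordinates are available because
`d ≥ 2`. -/
theorem exists_sphericalHarmonic (hd : 2 ≤ d) (ℓ : ℕ) : ∃ Y : unitSphere d → ℝ,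
    IsSphericalHarmonic d ℓ Y ∧ ∫ y, Y y * Y y ∂sphereMeasure d ≠ 0 := by
  set i : Fin d := ⟨0, by omega⟩
  set j : Fin d := ⟨1, by omega⟩
  have hij : i ≠ j := by simp [i, j]
  refine ⟨fun y => polyFun (planeHarmonic i j ℓ).1 (y : Sp d),
    ⟨(planeHarmonic i j ℓ).1, (planeHarmonic_isHomogeneous i j ℓ).1,
      laplacian_planeHarmonic hij ℓ, fun y => rfl⟩, ?_⟩
  have hc : Continuous fun y : unitSphere d => polyFun (planeHarmonic i j ℓ).1 (y : Sp d) :=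
    (contDiff_polyFun _).continuous.comp continuous_subtype_val
  refine ((hc.mul hc).integral_pos_of_hasCompactSupport_nonneg_nonzero
    (x := ⟨EuclideanSpace.single i 1, by simp⟩) (HasCompactSupport.of_compactSpace _)
    (fun y => mul_self_nonneg _) ?_).ne'
  simp [polyFun, (eval_planeHarmonic hij ℓ).1]

theorem existsUnique_isDtNEigenvalue (hd : 2 ≤ d) {q : Sp d → ℝ}
    (hq : MemLp q ∞ (ballMeasure d)) {κ : ℝ} {ℓ : ℕ} {a : ℝ} (ha : IsDtNEigenvalue q κ ℓ a) :
    (∃! lam : ℝ, IsDtNEigenvalue q κ ℓ lam) ∧ dtnEigenvalue q κ ℓ = a := by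
  obtain ⟨Y, hY, hY0⟩ := exists_sphericalHarmonic hd ℓ
  have huniq : ∀ b, IsDtNEigenvalue q κ ℓ b → b = a := fun b hb =>
    isDtN_smul_unique hq (hb Y hY) (ha Y hY) hY0
  exact ⟨⟨a, ha, huniq⟩, huniq _ (Classical.epsilon_spec ⟨a, ha⟩)⟩

end Uniqueness

/-! ### The moments -/

section Moments

/-- For a constant potential both integrations act on monomials, and the products of exponents
telescope into Gamma quotients. With `c = -κ` these are the terms of the Bessel series up to
normalisation. -/
theorem radialTerm_const (N : ℕ) (c : ℝ) (n : ℕ) (r : ℝ) :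
    radialTerm N (fun _ => c) n r = Real.Gamma ((N + 1) / 2) /
      (n.factorial * Real.Gamma ((N + 1) / 2 + n)) * (c * r ^ 2 / 4) ^ n := by
  induction n generalizing r with
  | zero =>
    have : Real.Gamma (((N : ℝ) + 1) / 2) ≠ 0 := (Real.Gamma_pos_of_pos (by positivity)).ne'
    simp [radialTerm, this]
  | succ n ih =>
    set A : ℝ := Real.Gamma ((N + 1) / 2) / (n.factorial * Real.Gamma ((N + 1) / 2 + n)) with hA
    have hin : ∀ s : ℝ, ∫ t in (0 : ℝ)..s, t ^ N * c * radialTerm N (fun _ => c) n t =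
        c * A * (c / 4) ^ n * (s ^ (N + 2 * n + 1) / (N + 2 * n + 1)) := by
      intro s
      have : ∀ t : ℝ, t ^ N * c * radialTerm N (fun _ => c) n t =
          c * A * (c / 4) ^ n * t ^ (N + 2 * n) := fun t => by
        rw [ih t, pow_add, pow_mul t 2 n]
        ring
      simp only [this]
      rw [intervalIntegral.integral_const_mul, integral_pow]
      push_cast
      simp
    have hout : radialTerm N (fun _ => c) (n + 1) r =
        ∫ s in (0 : ℝ)..|r|, c * A * (c / 4) ^ n / (N + 2 * n + 1) * s ^ (2 * n + 1) := by
      refine intervalIntegral.integral_congr fun s hs => ?_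
      rw [Set.uIcc_of_le (abs_nonneg r)] at hs
      simp only [hin]
      rcases hs.1.eq_or_lt with h0 | h0
      · rw [← h0]; simp
      · rw [show N + 2 * n + 1 = N + (2 * n + 1) by ring, pow_add s N]
        field_simp
    have hG : Real.Gamma (((N : ℝ) + 1) / 2 + n) ≠ 0 := (Real.Gamma_pos_of_pos (by positivity)).ne'
    have hrec : Real.Gamma (((N : ℝ) + 1) / 2 + (n + 1 : ℕ)) =
        (((N : ℝ) + 1) / 2 + n) * Real.Gamma (((N : ℝ) + 1) / 2 + n) := by
      rw [← Real.Gamma_add_one (by positivity)]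
      congr 1
      push_cast; ring
    rw [hout, intervalIntegral.integral_const_mul, integral_pow, hrec, hA, Nat.factorial_succ]
    have hr : |r| ^ (2 * n + 1 + 1) = (r ^ 2) ^ (n + 1) := by
      rw [← sq_abs r]; ring
    rw [hr]
    have hp : ((N : ℝ) + 1) / 2 + n ≠ 0 := by positivity
    have hp' : (N : ℝ) + 1 + 2 * n ≠ 0 := by positivity
    push_cast
    simp
    field_simp
    ring

variable {d : ℕ}

theorem csqrt_sq (κ : ℝ) : csqrt κ ^ 2 = κ := by
  have := Complex.cpow_nat_inv_pow (κ : ℂ) two_ne_zero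
  rw [csqrt, one_div]
  exact_mod_cast this

/-- Matches the Gamma argument of the radial series with that in `phi`, and later identifies the
Hardy constant. -/
theorem half_dim (hd : 2 ≤ d) (ℓ : ℕ) :
    (((d - 1 + 2 * ℓ : ℕ) : ℝ) + 1) / 2 = ℓ + nu d + 1 := by
  push_cast [Nat.cast_sub (by omega : 1 ≤ d)]
  simp only [nu]
  ring

/-- The factor between `φ_ℓ(√κ r)` and the regular radial solution with zero potential. -/
def phiFactor (d ℓ : ℕ) (κ : ℝ) : ℂ :=
  csqrt κ ^ ℓ / (((2 : ℝ) ^ ((ℓ : ℝ) + nu d) : ℝ) : ℂ) * ((Real.Gamma (ℓ + nu d + 1) : ℝ) : ℂ)⁻¹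

/-- Only even powers of `csqrt κ` occur in the series, so the complex root enters solely through a
prefactor independent of `r`. Its square cancels in the moment quotient. -/
theorem phi_csqrt_mul (hd : 2 ≤ d) (ℓ : ℕ) (κ r : ℝ) :
    phi d ℓ (csqrt κ * r) = phiFactor d ℓ κ *
      ((r ^ ℓ * radialSol (d - 1 + 2 * ℓ) (fun _ => -κ) r : ℝ) : ℂ) := by
  have hnu : 0 ≤ nu d := by
    have : (2 : ℝ) ≤ d := by exact_mod_cast hd
    simp only [nu]; linarith
  have hG : Real.Gamma (ℓ + nu d + 1) ≠ 0 := (Real.Gamma_pos_of_pos (by positivity)).ne'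
  have e : ∀ n : ℕ, (-1 : ℂ) ^ n / ((n.factorial : ℂ) * (Real.Gamma (ℓ + nu d + n + 1) : ℂ)) *
      (csqrt κ * r / 2) ^ (2 * n) = ((Real.Gamma (ℓ + nu d + 1) : ℝ) : ℂ)⁻¹ *
        ((radialTerm (d - 1 + 2 * ℓ) (fun _ => -κ) n r : ℝ) : ℂ) := by
    intro n
    have hG' : Real.Gamma (ℓ + nu d + 1 + n) ≠ 0 := (Real.Gamma_pos_of_pos (by positivity)).ne'
    rw [radialTerm_const, half_dim hd, pow_mul, div_pow, mul_pow, csqrt_sq,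
      show (ℓ : ℝ) + nu d + n + 1 = ℓ + nu d + 1 + n by ring]
    have hGc : ((Real.Gamma (ℓ + nu d + 1) : ℝ) : ℂ) ≠ 0 := by exact_mod_cast hG
    have hGc' : ((Real.Gamma (ℓ + nu d + 1 + n) : ℝ) : ℂ) ≠ 0 := by exact_mod_cast hG'
    have hpow : (((-κ * r ^ 2 / 4) ^ n : ℝ) : ℂ) = (-1) ^ n * ((κ : ℂ) * r ^ 2 / 2 ^ 2) ^ n := by
      rw [← mul_pow]
      push_cast
      congr 1
      ring
    rw [Complex.ofReal_mul, hpow]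
    push_cast
    field_simp
  rw [phi, tsum_congr e, tsum_mul_left, radialSol, ← Complex.ofReal_tsum, phiFactor]
  push_cast
  ring

theorem phiFactor_ne_zero (hd : 2 ≤ d) (ℓ : ℕ) {κ : ℝ} (hκ : κ ≠ 0) : phiFactor d ℓ κ ≠ 0 := by
  have hnu : 0 ≤ nu d := by
    have : (2 : ℝ) ≤ d := by exact_mod_cast hd
    simp only [nu]; linarith
  have hs : csqrt κ ≠ 0 := fun h => by
    have := csqrt_sq κ
    rw [h] at this
    exact hκ (by simpa using this.symm)
  have hG : Real.Gamma (ℓ + nu d + 1) ≠ 0 := (Real.Gamma_pos_of_pos (by positivity)).ne'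
  have h2 : (2 : ℝ) ^ ((ℓ : ℝ) + nu d) ≠ 0 := (Real.rpow_pos_of_pos two_pos _).ne'
  exact mul_ne_zero (div_ne_zero (pow_ne_zero _ hs) (by exact_mod_cast h2))
    (inv_ne_zero (by exact_mod_cast hG))

theorem moment_div_phi (hd : 2 ≤ d) {q : Sp d → ℝ} {p : ℝ → ℝ} {κ M : ℝ}
    (hpm : Measurable p) (hpM : ∀ r, |p r| ≤ M) (hκ : κ ≤ -M)
    (hqp : ∀ᵐ x ∂ballMeasure d, q x = p ‖x‖) (ℓ : ℕ) :
    moment q κ ℓ / phi d ℓ (csqrt κ) ^ 2 =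
      ((∫ t in (0 : ℝ)..1, t ^ (d - 1 + 2 * ℓ) * p t *
        normSol (d - 1 + 2 * ℓ) (fun _ => -κ) t ^ 2 : ℝ) : ℂ) := by
  have hM0 : 0 ≤ M := (abs_nonneg _).trans (hpM 0)
  set N := d - 1 + 2 * ℓ with hN
  set a := radialSol N (fun _ => -κ) with ha
  have hQ0 : ∀ t : ℝ, 0 ≤ (fun _ : ℝ => -κ) t := fun t => by simp only; linarith
  have hQm : Measurable fun _ : ℝ => -κ := measurable_const
  have hQK : ∀ t : ℝ, (fun _ : ℝ => -κ) t ≤ -κ := fun t => le_rfl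
  have ca : Continuous a := radialSol_continuous hQm hQ0 hQK
  have hmom : moment q κ ℓ = phiFactor d ℓ κ ^ 2 *
      ((∫ t in (0 : ℝ)..1, t ^ N * p t * a t ^ 2 : ℝ) : ℂ) := by
    have h1 : ∫ x in unitBall d, (q x : ℂ) * phi d ℓ (csqrt κ * (‖x‖ : ℂ)) ^ 2 =
        phiFactor d ℓ κ ^ 2 *
          ((∫ x in unitBall d, p ‖x‖ * (‖x‖ ^ ℓ * a ‖x‖) ^ 2 : ℝ) : ℂ) := by
      rw [← integral_complex_ofReal, ← integral_const_mul]
      refine integral_congr_ae ?_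
      filter_upwards [hqp] with x hx
      rw [hx, phi_csqrt_mul hd]
      push_cast
      ring
    have hint : IntegrableOn (fun x : Sp d => p ‖x‖ * (‖x‖ ^ ℓ * a ‖x‖) ^ 2) (unitBall d) := by
      obtain ⟨B, hB⟩ := exists_bound_unitBall
        (by fun_prop : Continuous fun x : Sp d => (‖x‖ ^ ℓ * a ‖x‖) ^ 2)
      refine memLp_one_iff_integrable.1 (memLp_unitBall (C := M * B) ?_ fun x hx => ?_)
      · exact ((hpm.comp measurable_norm).mul
          (by fun_prop : Continuous fun x : Sp d =>
            (‖x‖ ^ ℓ * a ‖x‖) ^ 2).measurable).aestronglyMeasurable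
      · rw [norm_mul]
        exact mul_le_mul (hpM _) (hB x hx) (norm_nonneg _) hM0
    have h2 : ∫ x in unitBall d, p ‖x‖ * (‖x‖ ^ ℓ * a ‖x‖) ^ 2 =
        (sphereMeasure d).real Set.univ * ∫ t in (0 : ℝ)..1, t ^ N * p t * a t ^ 2 := by
      rw [(setIntegral_ball_polar (by omega) hint).2, ← intervalIntegral.integral_const_mul]
      refine intervalIntegral.integral_congr fun t ht => ?_
      rw [Set.uIcc_of_le zero_le_one] at ht
      simp only [norm_smul_sphere ht.1, integral_const, smul_eq_mul]
      rw [hN]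
      ring
    have hS : (((sphereMeasure d).real Set.univ : ℝ) : ℂ) ≠ 0 := by
      have : NeZero (sphereMeasure d) := ⟨sphereMeasure_ne_zero (by omega)⟩
      exact_mod_cast (measureReal_univ_pos (μ := sphereMeasure d)).ne'
    rw [moment, h1, h2, Complex.ofReal_mul]
    field_simp
  have ha1 : a 1 ≠ 0 := (zero_lt_one.trans_le (one_le_radialSol hQm hQ0 hQK 1)).ne'
  have hnorm : ∫ t in (0 : ℝ)..1, t ^ N * p t * normSol N (fun _ => -κ) t ^ 2 =
      (∫ t in (0 : ℝ)..1, t ^ N * p t * a t ^ 2) / a 1 ^ 2 := by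
    rw [← intervalIntegral.integral_div]
    refine intervalIntegral.integral_congr fun t _ => ?_
    simp only [normSol, div_pow, ← ha]
    ring
  -- `κ = 0` forces `M = 0` and hence `p = 0`: both sides vanish, even where `phi` is zero and the
  -- quotient takes its default value.
  rcases eq_or_ne κ 0 with h0 | h0
  · have hp0 : ∀ r, p r = 0 := fun r => abs_nonpos_iff.1 ((hpM r).trans (by linarith))
    rw [hmom]
    simp [hp0]
  · have hphi : phi d ℓ (csqrt κ) = phiFactor d ℓ κ * (a 1 : ℂ) := by
      have := phi_csqrt_mul hd ℓ κ 1
      simpa using this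
    have hf := phiFactor_ne_zero hd ℓ h0
    have ha1' : (a 1 : ℂ) ≠ 0 := by exact_mod_cast ha1
    rw [hmom, hphi, hnorm]
    push_cast
    field_simp

end Moments

/-! ### The eigenvalue estimate and the uniform limit. -/

/-- The eigenvalues of the radial Dirichlet-to-Neumann map and the estimate of their distance to
the linearised ones, in terms of a profile of the potential. -/
theorem dtnEigenvalue_estimate {d : ℕ} (hd : 2 ≤ d) {q : Sp d → ℝ}
    (hq : IsBoundedRadial q) {κ : ℝ} (hκ : κ ≤ -supNorm q) (ℓ : ℕ) :
    (∃! lam : ℝ, IsDtNEigenvalue q κ ℓ lam) ∧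
    (∃! lam : ℝ, IsDtNEigenvalue (0 : Sp d → ℝ) κ ℓ lam) ∧
    (0 < (ℓ + nu d) ^ 2 - supNorm q - κ →
      ‖spectralGap q κ ℓ‖ ≤ supNorm q ^ 2 /
        ((2 * (ℓ + nu d) + 2) *
          ((ℓ + nu d) ^ 2 - supNorm q - κ))) := by
  obtain ⟨p, hpm, hpM, hqp⟩ := hq.exists_profile (by omega)
  set M := supNorm q with hM
  have hM0 : 0 ≤ M := ENNReal.toReal_nonneg
  have ex := isDtNEigenvalue_of_profile hd hpm hpM hκ hqp ℓ
  have ex0 := isDtNEigenvalue_of_profile (q := (0 : Sp d → ℝ)) (p := fun _ => 0) hd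
    measurable_const (M := M) (by simpa using hM0) hκ (by simp) ℓ
  obtain ⟨u, e⟩ := existsUnique_isDtNEigenvalue hd hq.memLp ex
  obtain ⟨u0, e0⟩ := existsUnique_isDtNEigenvalue hd MemLp.zero ex0
  refine ⟨u, u0, fun hD => ?_⟩
  have hs : shifted (fun _ => 0) κ = fun _ => -κ := by ext r; simp [shifted]
  rw [spectralGap, e, e0, moment_div_phi hd hpm hpM hκ hqp ℓ, hs]
  -- With `n = d - 2 + 2ℓ` the Hardy constant `(n/2)²` becomes `(ℓ + ν_d)²`, and `n + 2` becomes
  -- `2(ℓ + ν_d) + 2`.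
  obtain ⟨n, hn⟩ : ∃ n, d - 1 + 2 * ℓ = n + 1 := ⟨d - 2 + 2 * ℓ, by omega⟩
  have hn2 : (n : ℝ) / 2 = ℓ + nu d := by
    have h1 := half_dim hd ℓ
    rw [hn] at h1
    push_cast at h1
    linarith
  rw [hn]
  -- `m = -M - κ` is the lower bound of `p - κ`, which produces the denominator of the statement; `K
  -- = M - κ` bounds both potentials above.
  have key := abs_gap_le (n := n) (Q₁ := shifted p κ) (Q₂ := fun _ => -κ) (K := M - κ)
    (m := -M - κ) (M := M) (hpm.sub_const κ)
    (fun t => by have := (abs_le.1 (hpM t)).1; simp only [shifted]; linarith)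
    (fun t => by have := (abs_le.1 (hpM t)).2; simp only [shifted]; linarith)
    measurable_const (fun t => by linarith) (fun t => by linarith)
    (fun t => by have := (abs_le.1 (hpM t)).1; simp only [shifted]; linarith)
    (fun t => by simpa [shifted] using hpM t) (by rw [hn2]; linarith)
  have hsub : ∀ t, shifted p κ t - -κ = p t := fun t => by simp [shifted]
  simp only [hsub] at key
  rw [← Complex.ofReal_sub, ← Complex.ofReal_sub, Complex.norm_real, Real.norm_eq_abs,
    add_sub_add_left_eq_sub]
  refine key.trans (le_of_eq ?_)
  rw [hn2, show (n : ℝ) + 2 = 2 * (ℓ + nu d) + 2 by rw [← hn2]; ring]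
  congr 2
  ring

end RadialDtN

end

theorem mainTheorem10 (d : ℕ) (hd : 2 ≤ d) (q : RadialDtN.Sp d → ℝ)
    (hq : RadialDtN.IsBoundedRadial q) :
    (∀ κ : ℝ, κ ≤ -RadialDtN.supNorm q → ∀ ℓ : ℕ,
      (∃! lam : ℝ, RadialDtN.IsDtNEigenvalue q κ ℓ lam) ∧
      (∃! lam : ℝ, RadialDtN.IsDtNEigenvalue (0 : RadialDtN.Sp d → ℝ) κ ℓ lam) ∧
      (¬(d = 2 ∧ ℓ = 0) →
        ‖RadialDtN.spectralGap q κ ℓ‖ ≤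
          RadialDtN.supNorm q ^ 2 /
            (2 * (ℓ + RadialDtN.nu d) *
              ((ℓ + RadialDtN.nu d) ^ 2 - RadialDtN.supNorm q - κ)))) ∧
    TendstoUniformly (fun (κ : ℝ) (ℓ : ℕ) => RadialDtN.spectralGap q κ ℓ) (fun _ => 0) atBot := by
  have hd' : (2 : ℝ) ≤ d := by exact_mod_cast hd
  have hnu : 0 ≤ RadialDtN.nu d := by simp only [RadialDtN.nu]; linarith
  have hM0 : 0 ≤ RadialDtN.supNorm q := ENNReal.toReal_nonneg
  refine ⟨fun κ hκ ℓ => ?_, ?_⟩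
  · obtain ⟨h1, h2, h3⟩ := RadialDtN.dtnEigenvalue_estimate hd hq hκ ℓ
    refine ⟨h1, h2, fun hne => ?_⟩
    have hpos : 0 < (ℓ : ℝ) + RadialDtN.nu d := by
      rcases Nat.eq_zero_or_pos ℓ with rfl | hℓ
      · have : (3 : ℝ) ≤ d := by
          have : 3 ≤ d := by
            rcases hd.eq_or_lt with h | h
            · exact absurd ⟨h.symm, rfl⟩ hne
            · exact h
          exact_mod_cast this
        simp only [RadialDtN.nu, Nat.cast_zero]; linarith
      · have : (1 : ℝ) ≤ ℓ := by exact_mod_cast hℓ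
        linarith
    have hD : 0 < (ℓ + RadialDtN.nu d) ^ 2 - RadialDtN.supNorm q - κ := by
      have := pow_pos hpos 2
      linarith
    refine (h3 hD).trans ?_
    gcongr
    linarith
  · rw [Metric.tendstoUniformly_iff]
    intro ε hε
    set M := RadialDtN.supNorm q
    -- The threshold makes the second factor of the denominator at least `M² / ε + 1` for every `ℓ`;
    -- the first factor is at least `2`, of which only `≥ 1` is used. Hence the bound is strictly
    -- below `ε`, also for `(d, ℓ) = (2, 0)`.
    filter_upwards [eventually_le_atBot (-M - M ^ 2 / ε - 1)] with κ hκ ℓ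
    have hq0 : 0 ≤ M ^ 2 / ε := by positivity
    have hD : M ^ 2 / ε + 1 ≤ (ℓ + RadialDtN.nu d) ^ 2 - M - κ := by
      have := sq_nonneg ((ℓ : ℝ) + RadialDtN.nu d)
      linarith
    have h3 := (RadialDtN.dtnEigenvalue_estimate hd hq (by linarith : κ ≤ -M) ℓ).2.2
      (by linarith)
    rw [dist_zero_left]
    refine h3.trans_lt ?_
    have hc : 1 ≤ 2 * ((ℓ : ℝ) + RadialDtN.nu d) + 2 := by
      have : (0 : ℝ) ≤ ℓ := by positivity
      linarith
    have h4 : M ^ 2 / ε + 1 ≤ (2 * ((ℓ : ℝ) + RadialDtN.nu d) + 2) *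
        ((ℓ + RadialDtN.nu d) ^ 2 - M - κ) :=
      hD.trans (le_mul_of_one_le_left (by linarith) hc)
    rw [div_lt_iff₀ (by linarith)]
    calc M ^ 2 < ε * (M ^ 2 / ε + 1) := by
          rw [mul_add, mul_div_cancel₀ _ hε.ne']; linarith
      _ ≤ _ := by gcongr
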